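/- (Tweedie's formula for CIR processes.) Let $\alpha,\mu,\sigma:[0,\infty)\to(0,\infty)$ be such that $\alpha$ and $\sigma^2$ are locally integrable on $[0,\infty)$ and the index $\nu:=\frac{2\alpha(t)\mu(t)}{\sigma^2(t)}-1$ does not depend on $t\ge 0$ (so $\nu>-1$). Let $X=(X_t)_{t\ge0}$ be a continuous nonnegative (weak) solution of $$\mathrm dX_t=\alpha(t)(\mu(t)-X_t)\,\mathrm dt+\sigma(t)\sqrt{X_t}\,\mathrm dW_t,\qquad X_0\sim p_{\mathrm{data}},$$ and let $Z=(Z_t)_{t\ge 0}$ be a squared Bessel process of index $\nu$ with the same initial law, i.e. a continuous nonnegative (weak) solution of $$\mathrm dZ_t=2(\nu+1)\,\mathrm dt+2\sqrt{Z_t}\,\mathrm dW_t,\qquad Z_0\sim p_{\mathrm{data}}.$$ Here $p_{\mathrm{data}}$ is an arbitrary probability measure on $[0,\infty)$, and weak solutions are understood in the sense of the martingale problem. Let $A(t)=\int_0^t\alpha(s)\,\mathrm ds$ and $\tau(t)=\frac14\int_0^t\sigma^2(s)e^{A(s)}\,\mathrm ds$. Then for every $t>0$ the laws of $X_t$ and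 $Z_{\tau(t)}$ have positive continuously differentiable densities $p(t,\cdot)$ and $p^{\mathrm{BESQ}}_\nu(\tau(t),\cdot)$ on $(0,\infty)$, and for every $x>0$ $$\nabla\log p(t,x)=e^{A(t)}\,s^{\mathrm{BESQ}}_\nu\bigl(\tau(t),\,e^{A(t)}x\bigr),$$ where $s^{\mathrm{BESQ}}_\nu(r,y):=\nabla\log p^{\mathrm{BESQ}}_\nu(r,y)$. Moreover, for $r=\tau(t)$ and $y=e^{A(t)}x$, for almost every $x>0$, the conditional expectation below is that of an integrable variable and $$s^{\mathrm{BESQ}}_\nu(r,y)=\frac{\nu}{y}-\frac1{2r}+\frac1{2r\sqrt y}\,\mathbb E\!\left(\frac{\sqrt{Z_0}\,I_{\nu+1}\bigl(\sqrt{yZ_0}/r\bigr)}{I_\nu\bigl(\sqrt{yZ_0}/r\bigr)}\,\Big|\,Z_r=y\right),$$ where $I_\nu$ is the modified Bessel function of the first kind of order $\nu$ and the quotient is read as $0$ where $Z_0=0$. In particular, if $\alpha,\mu,\sigma$ are constants, then with $\nu=\frac{2\alpha\mu}{\sigma^2}-1$ the same holds in the form $$\nabla\log p(t,x)=e^{\alpha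 t}\,s^{\mathrm{BESQ}}_{\nu}\Bigl(\frac{\sigma^2}{4\alpha}(e^{\alpha t}-1),\,e^{\alpha t}x\Bigr).$$ -/

import Mathlib

open MeasureTheory ProbabilityTheory Set
open scoped NNReal ENNReal

noncomputable section

/-- The time-dependent generator `b(t,x) f'(x) + (1/2) σ(t,x)² f''(x)` of the one-dimensional
stochastic differential equation `dX = b(t,X) dt + σ(t,X) dW`. -/
def sdeGenerator (b σ : ℝ → ℝ → ℝ) (f : ℝ → ℝ) (t x : ℝ) : ℝ :=
  b t x * deriv f x + (1 / 2) * (σ t x) ^ 2 * iteratedDeriv 2 f x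

/-- `X` is a continuous nonnegative weak solution of `dX = b(t,X) dt + σ(t,X) dW`, in the sense of
the Stroock–Varadhan martingale problem: for every smooth compactly supported test function `f`,
`f(X_t) - f(X_0) - ∫₀ᵗ (L_s f)(X_s) ds` is a martingale for the filtration `𝓕`. The test functions
need not vanish near `0`, so the equation also governs the behaviour of `X` at the boundary. -/
structure IsNonnegSDESolution {Ω : Type*} [mΩ : MeasurableSpace Ω] (P : Measure Ω)
    (𝓕 : Filtration ℝ≥0 mΩ) (b σ : ℝ → ℝ → ℝ) (X : ℝ≥0 → Ω → ℝ) : Prop where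
  adapted : StronglyAdapted 𝓕 X
  continuous_paths : ∀ ω, Continuous fun t => X t ω
  nonneg : ∀ t ω, 0 ≤ X t ω
  martingale : ∀ f : ℝ → ℝ, ContDiff ℝ ((⊤ : ℕ∞) : WithTop ℕ∞) f → HasCompactSupport f →
    Martingale (fun (t : ℝ≥0) (ω : Ω) => f (X t ω) - f (X 0 ω) -
      ∫ r in (0 : ℝ)..t, sdeGenerator b σ f r (X r.toNNReal ω)) 𝓕 P

/-- The squared Bessel process of index `ν`: `dZ = 2(ν+1) dt + 2 √Z dW`. -/
def IsBESQ {Ω : Type*} [mΩ : MeasurableSpace Ω] (P : Measure Ω)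
    (𝓕 : Filtration ℝ≥0 mΩ) (ν : ℝ) (Z : ℝ≥0 → Ω → ℝ) : Prop :=
  IsNonnegSDESolution P 𝓕 (fun _ _ => 2 * (ν + 1)) (fun _ x => 2 * √x) Z

/-- The Cox–Ingersoll–Ross process: `dX = α(t) (μ(t) - X) dt + σ(t) √X dW`. -/
def IsCIR {Ω : Type*} [mΩ : MeasurableSpace Ω] (P : Measure Ω)
    (𝓕 : Filtration ℝ≥0 mΩ) (α μ σ : ℝ → ℝ) (X : ℝ≥0 → Ω → ℝ) : Prop :=
  IsNonnegSDESolution P 𝓕 (fun t x => α t * (μ t - x)) (fun t x => σ t * √x) X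

/-- The modified Bessel function of the first kind of order `ν`, at `u ≥ 0`. -/
def besselI (ν u : ℝ) : ℝ :=
  ∑' k : ℕ, (u / 2) ^ (2 * (k : ℝ) + ν) / ((Nat.factorial k : ℝ) * Real.Gamma ((k : ℝ) + ν + 1))

/-- `√z I_{ν+1}(√(xz)/t) / I_ν(√(xz)/t)`; its value is `0` at `z = 0`, which is also its limit. -/
def besselWeight (ν t x z : ℝ) : ℝ :=
  √z * besselI (ν + 1) (√(x * z) / t) / besselI ν (√(x * z) / t)

/-- `ν/x - 1/(2t) + (1/(2t√x)) E[√Z₀ I_{ν+1}(√(xZ₀)/t) / I_ν(√(xZ₀)/t) | Z_t = x]`, the conditional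
expectation being taken under the regular conditional law of `Z₀` given `Z_t = x`. -/
def besqTweedie {Ω : Type*} [MeasurableSpace Ω] (P : Measure Ω) [IsFiniteMeasure P]
    (Z : ℝ≥0 → Ω → ℝ) (ν t x : ℝ) : ℝ :=
  ν / x - 1 / (2 * t) + 1 / (2 * t * √x) *
    ∫ z, besselWeight ν t x z ∂(condDistrib (Z 0) (Z t.toNNReal) P x)

/-- The law `m` is carried by `(0,∞)` and has there the positive, continuously differentiable
density `p` (which is unique on `(0,∞)`, being continuous). -/
structure IsPosDensity (m : Measure ℝ) (p : ℝ → ℝ) : Prop where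
  pos : ∀ x, 0 < x → 0 < p x
  smooth : ContDiffOn ℝ 1 p (Ioi 0)
  law_eq : m = (volume.restrict (Ioi 0)).withDensity fun x => ENNReal.ofReal (p x)

/-- The score `∇ log p`. -/
def score (p : ℝ → ℝ) (x : ℝ) : ℝ := deriv (fun u => Real.log (p u)) x

/-- Tweedie's formula `∇ log p(t,x) = e^a s_ν(τ, e^a x)`, where `p(t,·)` is the density of `X_t` and
`s_ν(τ,·)` is the score of the density of `Z_τ`, which is also given by `besqTweedie`. The identity
of the scores holds at every `x > 0`, and that with the conditional expectation at almost every
`x > 0`, since a conditional expectation given `Z_τ = y` is only determined for almost every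
`y`. -/
def TweedieFormula {Ω Ω' : Type*} [MeasurableSpace Ω] [MeasurableSpace Ω']
    (P : Measure Ω) (P' : Measure Ω') [IsFiniteMeasure P']
    (X : ℝ≥0 → Ω → ℝ) (Z : ℝ≥0 → Ω' → ℝ) (ν t a τ : ℝ) : Prop :=
  ∃ p q : ℝ → ℝ,
    IsPosDensity (P.map (X t.toNNReal)) p ∧
    IsPosDensity (P'.map (Z τ.toNNReal)) q ∧
    (∀ x, 0 < x → score p x = Real.exp a * score q (Real.exp a * x)) ∧
    (∀ᵐ x ∂(volume.restrict (Ioi (0 : ℝ))),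
      Integrable (besselWeight ν τ (Real.exp a * x))
        (condDistrib (Z 0) (Z τ.toNNReal) P' (Real.exp a * x)) ∧
      score p x = Real.exp a * besqTweedie P' Z ν τ (Real.exp a * x))

end

/-! Both equations are instances of one with affine coefficients: drift `(ν + 1) / 2 * S - a * x`
and squared diffusion `S * x`. The Cox–Ingersoll–Ross process has `a = α`, `S = σ²`; the constancy
of the index is exactly what makes the constant part of its drift proportional to `σ²`. The squared
Bessel process has `a = 0`, `S = 4`.

For such a process the Laplace transform `M(λ, r) = E[e^{-λ X_r}; X_0 ∈ B]` solves a first-order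
linear equation in `(λ, r)`. It is obtained by inserting exponentials into the martingale problem
through a cutoff (`IsNonnegSDESolution.laplaceMoment_sub_zero`). The characteristics solve `λ' = a λ
+ S λ² / 2`, and they are explicit: `λ = θ(τ) e^A` with `θ' = 2 θ²`. Since `a` and `S` are merely
integrable, constancy along a characteristic is proved by comparing increments (`eq_along_curve`).
The outcome, `IsNonnegSDESolution.laplaceMoment_eq`, is the transform of the squared Bessel kernel
at time `τ` integrated over the initial law, so uniqueness of Laplace transforms identifies the law
of `e^A X_t` on every event `X_0 ∈ B` (`IsNonnegSDESolution.map_exp_mul_restrict`). No coupling or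
time change of paths is needed.

With `B` the whole line this gives the densities, and the factor `e^A` in the score is the chain
rule for a dilation. With general `B`, applied to `Z`, it gives the joint law of `(Z_0, Z_T)` and
hence Bayes' formula for the conditional law (`IsBESQ.condDistrib_ae_eq`). The density is `y^ν
e^{-y/(2T)}` times an integral of the entire series behind `I_ν`. Differentiating that series raises
`ν` by one, so the logarithmic derivative of the integral is the posterior mean of a quotient
`I_{ν+1} / I_ν`. -/

open Filter Topology

/-! ### The entire series behind the modified Bessel function. -/

/-- The coefficients `1 / (k! Γ(k + ν + 1))` of the entire function `besselSeries ν`. -/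
noncomputable def besselCoeff (ν : ℝ) (k : ℕ) : ℝ :=
  1 / ((Nat.factorial k : ℝ) * Real.Gamma ((k : ℝ) + ν + 1))

/-- The entire function `w ↦ ∑ wᵏ / (k! Γ(k + ν + 1))`, so that
`I_ν(u) = (u / 2) ^ ν * besselSeries ν (u² / 4)`. -/
noncomputable def besselSeries (ν w : ℝ) : ℝ := ∑' k : ℕ, besselCoeff ν k * w ^ k

lemma besselCoeff_pos {ν : ℝ} (hν : -1 < ν) (k : ℕ) : 0 < besselCoeff ν k := by
  have hk : (0 : ℝ) ≤ k := Nat.cast_nonneg k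
  have := Real.Gamma_pos_of_pos (s := (k : ℝ) + ν + 1) (by linarith)
  unfold besselCoeff
  positivity

lemma besselCoeff_succ (ν : ℝ) (k : ℕ) :
    besselCoeff ν (k + 1) * (k + 1) = besselCoeff (ν + 1) k := by
  have e : ((k + 1 : ℕ) : ℝ) + ν + 1 = (k : ℝ) + (ν + 1) + 1 := by push_cast; ring
  have hk : (k : ℝ) + 1 ≠ 0 := by positivity
  rw [besselCoeff, besselCoeff, e, Nat.factorial_succ]
  push_cast
  rw [mul_assoc, div_mul_eq_mul_div, one_mul, div_mul_cancel_left₀ hk, one_div]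

/-- `1 / Γ(k + ν + 1)` decays faster than every geometric sequence. -/
lemma exists_one_div_Gamma_le {ν : ℝ} (hν : -1 < ν) {c : ℝ} (hc : 0 < c) :
    ∃ C : ℝ, 0 < C ∧ ∀ k : ℕ, 1 / Real.Gamma ((k : ℝ) + ν + 1) ≤ C * c ^ k := by
  set u : ℕ → ℝ := fun k => 1 / (c ^ k * Real.Gamma ((k : ℝ) + ν + 1)) with hu
  have hG : ∀ k : ℕ, 0 < Real.Gamma ((k : ℝ) + ν + 1) := fun k =>
    Real.Gamma_pos_of_pos (by have hk : (0 : ℝ) ≤ k := Nat.cast_nonneg k; linarith)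
  have hupos : ∀ k, 0 < u k := fun k => by
    have := hG k
    simp only [hu]; positivity
  have hs : Summable u := by
    refine summable_of_ratio_test_tendsto_lt_one zero_lt_one
      (Eventually.of_forall fun k => (hupos k).ne') ?_
    have e : ∀ k : ℕ, ‖u (k + 1)‖ / ‖u k‖ = c⁻¹ * ((k : ℝ) + ν + 1)⁻¹ := by
      intro k
      have hk : (0 : ℝ) < (k : ℝ) + ν + 1 := by
        have hk : (0 : ℝ) ≤ k := Nat.cast_nonneg k
        linarith
      rw [Real.norm_of_nonneg (hupos _).le, Real.norm_of_nonneg (hupos _).le]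
      have e1 : ((k + 1 : ℕ) : ℝ) + ν + 1 = ((k : ℝ) + ν + 1) + 1 := by push_cast; ring
      simp only [hu]
      rw [e1, Real.Gamma_add_one hk.ne', pow_succ]
      have := (hG k).ne'
      field_simp
    simp_rw [e, add_assoc]
    rw [show (0 : ℝ) = c⁻¹ * 0 by simp]
    refine Tendsto.const_mul _ (tendsto_inv_atTop_zero.comp ?_)
    exact tendsto_atTop_add_const_right _ _ tendsto_natCast_atTop_atTop
  -- A term of a convergent positive series is at most its sum, which therefore serves as the
  -- constant.
  refine ⟨∑' k, u k, hs.tsum_pos (fun k => (hupos k).le) 0 (hupos 0), fun k => ?_⟩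
  have h1 : u k ≤ ∑' k, u k := hs.le_tsum k fun j _ => (hupos j).le
  have h2 : 1 / Real.Gamma ((k : ℝ) + ν + 1) = u k * c ^ k := by
    have := (hG k).ne'
    simp only [hu]; field_simp
  rw [h2]
  gcongr

/-- `besselSeries ν` grows more slowly than `exp (c * |w|)` for every `c > 0`. -/
lemma besselCoeff_mul_pow_bound {ν : ℝ} (hν : -1 < ν) {c : ℝ} (hc : 0 < c) :
    ∃ C : ℝ, 0 < C ∧ ∀ w : ℝ, Summable (fun k => |besselCoeff ν k * w ^ k|) ∧
      ∑' k, |besselCoeff ν k * w ^ k| ≤ C * Real.exp (c * |w|) := by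
  obtain ⟨C, hC, h⟩ := exists_one_div_Gamma_le hν hc
  refine ⟨C, hC, fun w => ?_⟩
  -- The Gamma factor is traded for `c ^ k`, while the factorial is kept to form the exponential
  -- series of `c * |w|`.
  have hle : ∀ k, |besselCoeff ν k * w ^ k| ≤ C * ((c * |w|) ^ k / (Nat.factorial k : ℝ)) := by
    intro k
    rw [abs_mul, abs_of_pos (besselCoeff_pos hν k), abs_pow, besselCoeff]
    calc 1 / ((Nat.factorial k : ℝ) * Real.Gamma ((k : ℝ) + ν + 1)) * |w| ^ k
        = 1 / Real.Gamma ((k : ℝ) + ν + 1) * (|w| ^ k / (Nat.factorial k : ℝ)) := by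
          rw [← one_div_mul_one_div]; ring
      _ ≤ C * c ^ k * (|w| ^ k / (Nat.factorial k : ℝ)) := by gcongr; exact h k
      _ = _ := by rw [mul_pow]; ring
  have hs : Summable fun k : ℕ => C * ((c * |w|) ^ k / (Nat.factorial k : ℝ)) :=
    (Real.summable_pow_div_factorial _).mul_left C
  have hs' := Summable.of_nonneg_of_le (fun k => abs_nonneg _) hle hs
  refine ⟨hs', (hs'.tsum_le_tsum hle hs).trans ?_⟩
  rw [tsum_mul_left, Real.exp_eq_exp_ℝ, NormedSpace.exp_eq_tsum_div]

lemma summable_besselCoeff {ν : ℝ} (hν : -1 < ν) (w : ℝ) :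
    Summable fun k => besselCoeff ν k * w ^ k := by
  obtain ⟨C, -, h⟩ := besselCoeff_mul_pow_bound hν one_pos
  exact (h w).1.of_abs

lemma abs_besselSeries_le {ν : ℝ} (hν : -1 < ν) {c : ℝ} (hc : 0 < c) :
    ∃ C : ℝ, 0 < C ∧ ∀ w : ℝ, |besselSeries ν w| ≤ C * Real.exp (c * |w|) := by
  obtain ⟨C, hC, h⟩ := besselCoeff_mul_pow_bound hν hc
  refine ⟨C, hC, fun w => le_trans ?_ (h w).2⟩
  have := norm_tsum_le_tsum_norm (f := fun k => besselCoeff ν k * w ^ k) (h w).1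
  exact this

lemma besselSeries_pos {ν : ℝ} (hν : -1 < ν) {w : ℝ} (hw : 0 ≤ w) : 0 < besselSeries ν w := by
  refine (summable_besselCoeff hν w).tsum_pos (fun k => ?_) 0 ?_
  · exact mul_nonneg (besselCoeff_pos hν k).le (pow_nonneg hw k)
  · simpa using besselCoeff_pos hν 0

/-- Termwise differentiation cancels one factor of the factorial and shifts the Gamma argument,
which amounts to raising the index. This is where `I_{ν+1}` in Tweedie's formula originates. -/
lemma hasDerivAt_besselSeries {ν : ℝ} (hν : -1 < ν) (w : ℝ) :
    HasDerivAt (besselSeries ν) (besselSeries (ν + 1) w) w := by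
  set R : ℝ := |w| + 1
  have hν' : -1 < ν + 1 := by linarith
  -- The truncated exponent `k - 1` is harmless at `k = 0`, where the factor `k` kills the term; the
  -- series is therefore reindexed from `k + 1`.
  have hshift : ∀ y : ℝ, ∀ k : ℕ,
      besselCoeff ν (k + 1) * (((k + 1 : ℕ) : ℝ) * y ^ (k + 1 - 1)) =
        besselCoeff (ν + 1) k * y ^ k := by
    intro y k
    rw [← besselCoeff_succ, Nat.add_sub_cancel]
    push_cast
    ring
  have hsum : ∀ y : ℝ, Summable fun k : ℕ => besselCoeff ν k * ((k : ℝ) * y ^ (k - 1)) := by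
    intro y
    rw [← summable_nat_add_iff 1]
    simp_rw [hshift]
    exact summable_besselCoeff hν' y
  have h := hasDerivAt_tsum_of_isPreconnected (𝕜 := ℝ) (g := fun k y => besselCoeff ν k * y ^ k)
    (g' := fun k y => besselCoeff ν k * ((k : ℝ) * y ^ (k - 1)))
    (u := fun k => besselCoeff ν k * ((k : ℝ) * R ^ (k - 1))) (t := Ioo (-R) R) (y₀ := w) (y := w)
    (hsum R) isOpen_Ioo isPreconnected_Ioo
    (fun k y _ => (hasDerivAt_pow k y).const_mul _)
    (fun k y hy => by
      have hy' : |y| ≤ R := (abs_lt.2 hy).le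
      rw [norm_mul, norm_mul, norm_pow, Real.norm_of_nonneg (besselCoeff_pos hν k).le,
        Real.norm_natCast, Real.norm_eq_abs]
      have := (besselCoeff_pos hν k).le
      gcongr)
    (abs_lt.1 (by simp [R])) (summable_besselCoeff hν w) (abs_lt.1 (by simp [R]))
  have e : ∑' k : ℕ, besselCoeff ν k * ((k : ℝ) * w ^ (k - 1)) = besselSeries (ν + 1) w := by
    rw [(hsum w).tsum_eq_zero_add]
    simp_rw [hshift]
    simp [besselSeries]
  rw [e] at h
  exact h

lemma continuous_besselSeries {ν : ℝ} (hν : -1 < ν) : Continuous (besselSeries ν) :=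
  continuous_iff_continuousAt.2 fun w => (hasDerivAt_besselSeries hν w).continuousAt

lemma besselI_eq (ν : ℝ) {u : ℝ} (hu : 0 < u) :
    besselI ν u = (u / 2) ^ ν * besselSeries ν (u ^ 2 / 4) := by
  rw [besselI, besselSeries, ← tsum_mul_left]
  refine tsum_congr fun k => ?_
  rw [Real.rpow_add (by positivity), show (2 : ℝ) * (k : ℝ) = ((2 * k : ℕ) : ℝ) by push_cast; ring,
    Real.rpow_natCast, pow_mul, besselCoeff, show (u / 2) ^ 2 = u ^ 2 / 4 by ring]
  ring

/-- In the quotient the non-analytic factors `(u / 2) ^ ν` cancel, leaving a single `u / 2` that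
combines with `√z`. The resulting expression also covers `z = 0`. -/
lemma besselWeight_eq {ν t x z : ℝ} (ht : 0 < t) (hx : 0 < x) (hz : 0 ≤ z) :
    besselWeight ν t x z = z * √x / (2 * t) *
      (besselSeries (ν + 1) (z * x / (4 * t ^ 2)) / besselSeries ν (z * x / (4 * t ^ 2))) := by
  rcases hz.eq_or_lt with rfl | hz
  · simp [besselWeight]
  have hu : 0 < √(x * z) / t := by positivity
  have e : (√(x * z) / t) ^ 2 / 4 = z * x / (4 * t ^ 2) := by
    rw [div_pow, Real.sq_sqrt (by positivity)]; field_simp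
  rw [besselWeight, besselI_eq _ hu, besselI_eq _ hu, e, Real.rpow_add (by positivity),
    Real.rpow_one]
  have h1 : (√(x * z) / t / 2) ^ ν ≠ 0 := (Real.rpow_pos_of_pos (by positivity) _).ne'
  have h2 : √z * √(x * z) = z * √x := by
    rw [Real.sqrt_mul hx.le, mul_left_comm, Real.mul_self_sqrt hz.le, mul_comm]
  rw [← h2]
  field_simp

/-! ### The squared Bessel kernel and its Laplace transform. -/

/-- The transition density of the squared Bessel process of index `ν`. -/
noncomputable def besqKernel (ν T z y : ℝ) : ℝ :=
  (2 * T) ^ (-(ν + 1)) * y ^ ν * Real.exp (-(z + y) / (2 * T)) *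
    besselSeries ν (z * y / (4 * T ^ 2))

lemma measurable_besqKernel {ν : ℝ} (hν : -1 < ν) (T : ℝ) :
    Measurable (Function.uncurry (besqKernel ν T)) := by
  have := (continuous_besselSeries hν).measurable
  unfold besqKernel Function.uncurry
  fun_prop

/-- The squared Bessel transition density is a Poisson mixture of gamma densities. -/
lemma hasSum_exp_mul_besqKernel {ν T l z y : ℝ} (hν : -1 < ν) (hT : 0 < T) (hl : 0 ≤ l)
    (hy : 0 < y) :
    HasSum (fun k : ℕ => (1 + 2 * T * l) ^ (-(ν + 1)) * Real.exp (-z / (2 * T)) *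
        ((z / (2 * T * (1 + 2 * T * l))) ^ k / (Nat.factorial k : ℝ)) *
        gammaPDFReal ((k : ℝ) + ν + 1) ((1 + 2 * T * l) / (2 * T)) y)
      (Real.exp (-(l * y)) * besqKernel ν T z y) := by
  have h := (summable_besselCoeff hν (z * y / (4 * T ^ 2))).hasSum.mul_left
    (Real.exp (-(l * y)) * ((2 * T) ^ (-(ν + 1)) * y ^ ν * Real.exp (-(z + y) / (2 * T))))
  have e : Real.exp (-(l * y)) * ((2 * T) ^ (-(ν + 1)) * y ^ ν * Real.exp (-(z + y) / (2 * T))) *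
      (∑' k, besselCoeff ν k * (z * y / (4 * T ^ 2)) ^ k) =
      Real.exp (-(l * y)) * besqKernel ν T z y := by
    rw [besqKernel, besselSeries, mul_assoc (Real.exp (-(l * y)))]
  rw [e] at h
  refine h.congr_fun ?_
  intro k
  have hD : 0 < 1 + 2 * T * l := by positivity
  set D := 1 + 2 * T * l with hDdef
  have hG : Real.Gamma ((k : ℝ) + ν + 1) ≠ 0 :=
    (Real.Gamma_pos_of_pos (by have hk : (0 : ℝ) ≤ k := Nat.cast_nonneg k; linarith)).ne'
  rw [gammaPDFReal, if_pos hy.le, besselCoeff]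
  have e1 : (D / (2 * T)) ^ ((k : ℝ) + ν + 1) =
      (D / (2 * T)) ^ k * (D ^ (ν + 1) * (2 * T) ^ (-(ν + 1))) := by
    rw [show (k : ℝ) + ν + 1 = k + (ν + 1) by ring, Real.rpow_add (by positivity),
      Real.rpow_natCast, Real.div_rpow hD.le (by positivity), Real.rpow_neg (by positivity),
      div_eq_mul_inv (D ^ (ν + 1))]
  have e2 : y ^ ((k : ℝ) + ν + 1 - 1) = y ^ k * y ^ ν := by
    rw [show (k : ℝ) + ν + 1 - 1 = k + ν by ring, Real.rpow_add hy, Real.rpow_natCast]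
  have e3 : D ^ (-(ν + 1)) * D ^ (ν + 1) = 1 := by
    rw [← Real.rpow_add hD]; simp
  -- Tilting by `e^{-ly}` changes the gamma rate from `1 / (2T)` to `D / (2T)`.
  have e4 : Real.exp (-(l * y)) * Real.exp (-(z + y) / (2 * T)) =
      Real.exp (-z / (2 * T)) * Real.exp (-(D / (2 * T) * y)) := by
    rw [← Real.exp_add, ← Real.exp_add]
    congr 1
    rw [hDdef]; field_simp; ring
  have e5 : (z / (2 * T * D)) ^ k * (D / (2 * T)) ^ k * y ^ k = (z * y / (4 * T ^ 2)) ^ k := by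
    rw [← mul_pow, ← mul_pow]
    congr 1
    field_simp; ring
  rw [e1, e2, ← e5]
  calc _ = (D ^ (-(ν + 1)) * D ^ (ν + 1)) * (2 * T) ^ (-(ν + 1)) * y ^ ν *
        (Real.exp (-z / (2 * T)) * Real.exp (-(D / (2 * T) * y))) *
        ((z / (2 * T * D)) ^ k * (D / (2 * T)) ^ k * y ^ k) *
        (1 / ((Nat.factorial k : ℝ) * Real.Gamma ((k : ℝ) + ν + 1))) := by
          field_simp
    _ = _ := by rw [e3, ← e4]; ring

/-- The Laplace transform of the squared Bessel transition density. -/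
lemma lintegral_exp_mul_besqKernel {ν T l z : ℝ} (hν : -1 < ν) (hT : 0 < T) (hl : 0 ≤ l)
    (hz : 0 ≤ z) :
    ∫⁻ y in Ioi 0, ENNReal.ofReal (Real.exp (-(l * y)) * besqKernel ν T z y) =
      ENNReal.ofReal ((1 + 2 * T * l) ^ (-(ν + 1)) * Real.exp (-(l / (1 + 2 * T * l) * z))) := by
  have hD : 0 < 1 + 2 * T * l := by positivity
  set c : ℕ → ℝ := fun k => (1 + 2 * T * l) ^ (-(ν + 1)) * Real.exp (-z / (2 * T)) *
        ((z / (2 * T * (1 + 2 * T * l))) ^ k / (Nat.factorial k : ℝ)) with hc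
  have hc0 : ∀ k, 0 ≤ c k := fun k => by
    have := Real.rpow_nonneg hD.le (-(ν + 1))
    simp only [hc]; positivity
  have ha : ∀ k : ℕ, 0 < (k : ℝ) + ν + 1 := fun k => by
    have hk : (0 : ℝ) ≤ k := Nat.cast_nonneg k
    linarith
  have hr : 0 < (1 + 2 * T * l) / (2 * T) := by positivity
  have hg0 : ∀ k : ℕ, ∀ y, 0 ≤ gammaPDFReal ((k : ℝ) + ν + 1) ((1 + 2 * T * l) / (2 * T)) y :=
    fun k y => gammaPDFReal_nonneg (ha k) hr y
  -- Each gamma density has mass one, so only the sum of the mixture weights remains, an exponential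
  -- series.
  have hcs : HasSum c ((1 + 2 * T * l) ^ (-(ν + 1)) * Real.exp (-(l / (1 + 2 * T * l) * z))) := by
    have h := (NormedSpace.expSeries_div_hasSum_exp (z / (2 * T * (1 + 2 * T * l)))).mul_left
      ((1 + 2 * T * l) ^ (-(ν + 1)) * Real.exp (-z / (2 * T)))
    rw [← Real.exp_eq_exp_ℝ, mul_assoc (_ ^ (-(ν + 1))), ← Real.exp_add] at h
    convert! h using 3
    field_simp
    ring
  have h1 : ∫⁻ y in Ioi 0, ENNReal.ofReal (Real.exp (-(l * y)) * besqKernel ν T z y) =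
      ∫⁻ y in Ioi 0, ∑' k : ℕ, ENNReal.ofReal (c k) *
        gammaPDF ((k : ℝ) + ν + 1) ((1 + 2 * T * l) / (2 * T)) y := by
    refine setLIntegral_congr_fun measurableSet_Ioi fun y hy => ?_
    have hs := hasSum_exp_mul_besqKernel (z := z) hν hT hl (mem_Ioi.1 hy)
    rw [← hs.tsum_eq, ENNReal.ofReal_tsum_of_nonneg
      (fun k => mul_nonneg (hc0 k) (hg0 k y)) hs.summable]
    exact tsum_congr fun k => ENNReal.ofReal_mul (hc0 k)
  have h2 : ∀ k : ℕ, ∫⁻ y in Ioi 0,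
      gammaPDF ((k : ℝ) + ν + 1) ((1 + 2 * T * l) / (2 * T)) y = 1 := by
    intro k
    rw [← lintegral_gammaPDF_eq_one (ha k) hr, ← lintegral_indicator measurableSet_Ioi]
    refine lintegral_congr_ae ?_
    filter_upwards [compl_mem_ae_iff.2 (measure_singleton (0 : ℝ))] with y hy
    by_cases h : y ∈ Ioi (0 : ℝ)
    · rw [indicator_of_mem h]
    · rw [indicator_of_notMem h, gammaPDF_of_neg]
      exact lt_of_le_of_ne (not_lt.1 h) hy
  rw [h1, lintegral_tsum fun k => ?_, ← hcs.tsum_eq, ENNReal.ofReal_tsum_of_nonneg hc0 hcs.summable]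
  · refine tsum_congr fun k => ?_
    rw [lintegral_const_mul' _ _ ENNReal.ofReal_ne_top, h2, mul_one]
  · exact ((measurable_gammaPDFReal _ _).ennreal_ofReal.const_mul _).aemeasurable

/-! ### Integrals of the Bessel series against the initial law. -/

/-- `∫ zʲ e^{-z/(2T)} ∑ (z y / (4 T²))ᵏ / (k! Γ(k + ν + 1)) m(dz)`. -/
noncomputable def besselMoment (m : Measure ℝ) (T ν : ℝ) (j : ℕ) (y : ℝ) : ℝ :=
  ∫ z, z ^ j * Real.exp (-z / (2 * T)) * besselSeries ν (z * y / (4 * T ^ 2)) ∂m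

/-- The series grows more slowly than any exponential, so the rate `T / R` can be chosen to make it
cost only `e^{z/(4T)}`. The power of `z` costs another `e^{z/(4T)}`, and `e^{-z/(2T)}` absorbs both
exactly. Hence no moment assumption on the initial law is needed. -/
lemma exists_besselMoment_integrand_bound {ν T : ℝ} (hν : -1 < ν) (hT : 0 < T) (j : ℕ) {R : ℝ}
    (hR : 0 < R) : ∃ C : ℝ, ∀ z y : ℝ, 0 ≤ z → |y| ≤ R →
      ‖z ^ j * Real.exp (-z / (2 * T)) * besselSeries ν (z * y / (4 * T ^ 2))‖ ≤ C := by
  obtain ⟨C, hC, h⟩ := abs_besselSeries_le hν (c := T / R) (by positivity)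
  refine ⟨(4 * T) ^ j * (Nat.factorial j) * C, fun z y hz hy => ?_⟩
  have h1 : z ^ j ≤ (4 * T) ^ j * (Nat.factorial j) * Real.exp (z / (4 * T)) := by
    have := Real.pow_div_factorial_le_exp (z / (4 * T)) (by positivity) j
    rw [div_pow, div_div, div_le_iff₀ (by positivity)] at this
    linarith
  have h2 : |besselSeries ν (z * y / (4 * T ^ 2))| ≤ C * Real.exp (z / (4 * T)) := by
    refine (h _).trans ?_
    gcongr
    rw [abs_div, abs_mul, abs_of_nonneg hz, abs_of_pos (by positivity : 0 < 4 * T ^ 2)]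
    calc T / R * (z * |y| / (4 * T ^ 2)) ≤ T / R * (z * R / (4 * T ^ 2)) := by gcongr
      _ = z / (4 * T) := by field_simp
  rw [norm_mul, norm_mul, Real.norm_of_nonneg (pow_nonneg hz j),
    Real.norm_of_nonneg (Real.exp_pos _).le, Real.norm_eq_abs]
  calc z ^ j * Real.exp (-z / (2 * T)) * |besselSeries ν (z * y / (4 * T ^ 2))|
      ≤ ((4 * T) ^ j * (Nat.factorial j) * Real.exp (z / (4 * T))) * Real.exp (-z / (2 * T)) *
        (C * Real.exp (z / (4 * T))) := by gcongr
    _ = (4 * T) ^ j * (Nat.factorial j) * C *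
        Real.exp (z / (4 * T) + -z / (2 * T) + z / (4 * T)) := by
        rw [Real.exp_add, Real.exp_add]; ring
    _ = _ := by
        rw [show z / (4 * T) + -z / (2 * T) + z / (4 * T) = 0 by field_simp; ring]
        simp

lemma integrable_besselMoment (m : Measure ℝ) [IsFiniteMeasure m] (hm : ∀ᵐ z ∂m, 0 ≤ z)
    {ν T : ℝ} (hν : -1 < ν) (hT : 0 < T) (j : ℕ) (y : ℝ) :
    Integrable (fun z => z ^ j * Real.exp (-z / (2 * T)) *
      besselSeries ν (z * y / (4 * T ^ 2))) m := by
  obtain ⟨C, hC⟩ := exists_besselMoment_integrand_bound hν hT j (R := |y| + 1) (by positivity)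
  have := continuous_besselSeries hν
  refine Integrable.of_bound (C := C) (by fun_prop) ?_
  filter_upwards [hm] with z hz using hC z y hz (by linarith)

lemma hasDerivAt_besselMoment (m : Measure ℝ) [IsFiniteMeasure m] (hm : ∀ᵐ z ∂m, 0 ≤ z)
    {ν T : ℝ} (hν : -1 < ν) (hT : 0 < T) (j : ℕ) (y : ℝ) :
    HasDerivAt (besselMoment m T ν j) (besselMoment m T (ν + 1) (j + 1) y / (4 * T ^ 2)) y := by
  have hν' : -1 < ν + 1 := by linarith
  obtain ⟨C, hC⟩ := exists_besselMoment_integrand_bound hν' hT (j + 1) (R := |y| + 1) (by positivity)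
  have hc := continuous_besselSeries hν
  have hc' := continuous_besselSeries hν'
  have h := hasDerivAt_integral_of_dominated_loc_of_deriv_le (μ := m)
    (s := Metric.ball y 1) (x₀ := y) (bound := fun _ => C / (4 * T ^ 2))
    (F := fun y z => z ^ j * Real.exp (-z / (2 * T)) * besselSeries ν (z * y / (4 * T ^ 2)))
    (F' := fun y z => z ^ (j + 1) * Real.exp (-z / (2 * T)) *
      besselSeries (ν + 1) (z * y / (4 * T ^ 2)) / (4 * T ^ 2))
    (Metric.ball_mem_nhds y one_pos)
    (Eventually.of_forall fun y => by fun_prop)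
    (integrable_besselMoment m hm hν hT j y) (by fun_prop) ?_ (integrable_const _) ?_
  · convert! h.2 using 1
    rw [besselMoment, integral_div]
  · filter_upwards [hm] with z hz x hx
    rw [norm_div, Real.norm_of_nonneg (by positivity : 0 ≤ 4 * T ^ 2)]
    gcongr
    refine hC z x hz ?_
    have h1 : |x - y| < 1 := by simpa [Real.dist_eq] using hx
    have h2 := abs_sub_abs_le_abs_sub x y
    linarith
  · refine Eventually.of_forall fun z x _ => ?_
    have h1 : HasDerivAt (fun x => z * x / (4 * T ^ 2)) (z / (4 * T ^ 2)) x := by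
      simpa using ((hasDerivAt_id x).const_mul z).div_const (4 * T ^ 2)
    convert! ((hasDerivAt_besselSeries hν _).comp x h1).const_mul
      (z ^ j * Real.exp (-z / (2 * T))) using 1
    ring

/-- The derivative is an integral of the same family, with `ν` and `j` raised by one, and is itself
differentiable. -/
lemma contDiff_besselMoment (m : Measure ℝ) [IsFiniteMeasure m] (hm : ∀ᵐ z ∂m, 0 ≤ z)
    {ν T : ℝ} (hν : -1 < ν) (hT : 0 < T) (j : ℕ) : ContDiff ℝ 1 (besselMoment m T ν j) := by
  refine contDiff_one_iff_deriv.2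
    ⟨fun y => (hasDerivAt_besselMoment m hm hν hT j y).differentiableAt, ?_⟩
  rw [funext fun y => (hasDerivAt_besselMoment m hm hν hT j y).deriv]
  refine Continuous.div_const (continuous_iff_continuousAt.2 fun y => ?_) _
  exact (hasDerivAt_besselMoment m hm (by linarith) hT (j + 1) y).continuousAt

lemma besselMoment_zero_pos (m : Measure ℝ) [IsProbabilityMeasure m] (hm : ∀ᵐ z ∂m, 0 ≤ z)
    {ν T : ℝ} (hν : -1 < ν) (hT : 0 < T) {y : ℝ} (hy : 0 ≤ y) :
    0 < besselMoment m T ν 0 y := by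
  have hpos : ∀ᵐ z ∂m, 0 < z ^ 0 * Real.exp (-z / (2 * T)) *
      besselSeries ν (z * y / (4 * T ^ 2)) := by
    filter_upwards [hm] with z hz
    have := besselSeries_pos hν (w := z * y / (4 * T ^ 2)) (by positivity)
    positivity
  rw [besselMoment, integral_pos_iff_support_of_nonneg_ae (hpos.mono fun z hz => hz.le)
    (integrable_besselMoment m hm hν hT 0 y)]
  have : (Function.support fun z => z ^ 0 * Real.exp (-z / (2 * T)) *
      besselSeries ν (z * y / (4 * T ^ 2))) =ᵐ[m] univ := by
    filter_upwards [hpos] with z hz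
    exact propext ⟨fun _ => trivial, fun _ => hz.ne'⟩
  rw [measure_congr this]
  simp

/-! ### Constancy along a curve with merely integrable velocity. -/

/-- A function whose increments are uniformly negligible compared with those of another function
is constant. -/
lemma eq_of_forall_abs_sub_le {F m : ℝ → ℝ} {T : ℝ} (hT : 0 ≤ T)
    (h : ∀ ε > 0, ∃ δ > 0, ∀ s t, 0 ≤ s → s ≤ t → t ≤ T → t - s < δ →
      |F t - F s| ≤ ε * (m t - m s)) : F T = F 0 := by
  have key : ∀ ε > 0, |F T - F 0| ≤ ε * (m T - m 0) := by
    intro ε hε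
    obtain ⟨δ, hδ, hd⟩ := h ε hε
    obtain ⟨n, hn⟩ := exists_nat_gt (T / δ)
    have hn0 : (0 : ℝ) < n := lt_of_le_of_lt (by positivity) hn
    have hstep : T / n < δ := by
      rw [div_lt_iff₀ hδ] at hn
      rw [div_lt_iff₀ hn0]
      linarith
    have hN : (n : ℝ) * (T / n) = T := by field_simp
    have e1 := Finset.sum_range_sub (fun i : ℕ => F (i * (T / n))) n
    have e2 := Finset.sum_range_sub (fun i : ℕ => m (i * (T / n))) n
    simp only [hN, Nat.cast_zero, zero_mul] at e1 e2
    rw [← e1, ← e2, Finset.mul_sum]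
    refine (Finset.abs_sum_le_sum_abs _ _).trans (Finset.sum_le_sum fun i hi => ?_)
    have hT' : 0 ≤ T / n := by positivity
    have hi' : ((i + 1 : ℕ) : ℝ) ≤ n := by exact_mod_cast Finset.mem_range.1 hi
    have hi2 : ((i + 1 : ℕ) : ℝ) * (T / n) ≤ T := by
      calc ((i + 1 : ℕ) : ℝ) * (T / n) ≤ n * (T / n) := by gcongr
        _ = T := hN
    refine hd _ _ (by positivity) ?_ hi2 ?_
    · push_cast; nlinarith
    · push_cast; linarith
  have h0 : |F T - F 0| ≤ 0 := by
    refine le_of_forall_pos_le_add fun ε hε => ?_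
    -- The `+ 1` keeps the denominator positive when `m` has no net increment.
    have h1 := key (ε / (|m T - m 0| + 1)) (by positivity)
    have h2 : ε / (|m T - m 0| + 1) * (m T - m 0) ≤ ε := by
      rw [div_mul_eq_mul_div, div_le_iff₀ (by positivity)]
      have := le_abs_self (m T - m 0)
      nlinarith
    linarith
  exact sub_eq_zero.1 (abs_nonpos_iff.1 h0)

/-- If `Φ(x, y, r)` changes with `r` in the way opposite to its change along the curve
`r ↦ (A(r), τ(r))`, then it is constant along this curve. The coefficients need only be
integrable. -/
lemma eq_along_curve {a S : ℝ → ℝ} {T : ℝ} (hT : 0 ≤ T)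
    (ha0 : ∀ r, 0 ≤ r → 0 ≤ a r) (hS0 : ∀ r, 0 ≤ r → 0 ≤ S r)
    (ha : IntervalIntegrable a volume 0 T) (hS : IntervalIntegrable S volume 0 T)
    {A τ : ℝ → ℝ} (hA : ∀ r, A r = ∫ u in (0 : ℝ)..r, a u)
    (hτ : ∀ r, τ r = 1 / 4 * ∫ u in (0 : ℝ)..r, S u * Real.exp (A u))
    {Φ k₁ k₂ : ℝ → ℝ → ℝ → ℝ}
    (hk₁ : ContinuousOn (fun q : ℝ × ℝ × ℝ => k₁ q.1 q.2.1 q.2.2)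
      (Icc 0 (A T) ×ˢ Icc 0 (τ T) ×ˢ Icc 0 T))
    (hk₂ : ContinuousOn (fun q : ℝ × ℝ × ℝ => k₂ q.1 q.2.1 q.2.2)
      (Icc 0 (A T) ×ˢ Icc 0 (τ T) ×ˢ Icc 0 T))
    (hΦ : ∀ r ∈ Icc 0 T, ∀ x x' y y' v : ℝ, x + v * x' ∈ Icc 0 (A T) → y + v * y' ∈ Icc 0 (τ T) →
      HasDerivAt (fun v => Φ (x + v * x') (y + v * y') r)
        (k₁ (x + v * x') (y + v * y') r * x' + k₂ (x + v * x') (y + v * y') r * y') v)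
    (hΦ' : ∀ x ∈ Icc 0 (A T), ∀ y ∈ Icc 0 (τ T), ∀ s t, 0 ≤ s → s ≤ t → t ≤ T →
      Φ x y t - Φ x y s =
        -∫ r in s..t, (a r * k₁ x y r + S r * (Real.exp x / 4 * k₂ x y r))) :
    Φ (A T) (τ T) T = Φ 0 0 0 := by
  have hsub : ∀ {s t : ℝ}, 0 ≤ s → s ≤ t → t ≤ T → uIcc s t ⊆ uIcc 0 T := by
    intro s t h0 h1 h2
    rw [uIcc_of_le h1, uIcc_of_le hT]
    exact Icc_subset_Icc h0 h2
  have haI : ∀ {s t : ℝ}, 0 ≤ s → s ≤ t → t ≤ T → IntervalIntegrable a volume s t :=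
    fun h0 h1 h2 => ha.mono_set (hsub h0 h1 h2)
  have hSI : ∀ {s t : ℝ}, 0 ≤ s → s ≤ t → t ≤ T → IntervalIntegrable S volume s t :=
    fun h0 h1 h2 => hS.mono_set (hsub h0 h1 h2)
  have hAc : ContinuousOn A (Icc 0 T) := by
    have := intervalIntegral.continuousOn_primitive_interval' ha (left_mem_uIcc)
    rw [uIcc_of_le hT] at this
    exact this.congr fun r _ => hA r
  have hSe : IntervalIntegrable (fun u => S u * Real.exp (A u)) volume 0 T := by
    refine hS.mul_continuousOn ?_
    rw [uIcc_of_le hT]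
    exact hAc.rexp
  have hSeI : ∀ {s t : ℝ}, 0 ≤ s → s ≤ t → t ≤ T →
      IntervalIntegrable (fun u => S u * Real.exp (A u)) volume s t :=
    fun h0 h1 h2 => hSe.mono_set (hsub h0 h1 h2)
  have hτc : ContinuousOn τ (Icc 0 T) := by
    have := intervalIntegral.continuousOn_primitive_interval' hSe (left_mem_uIcc)
    rw [uIcc_of_le hT] at this
    exact (this.const_smul (1 / 4 : ℝ)).congr fun r _ => hτ r
  have hAd : ∀ {s t : ℝ}, 0 ≤ s → s ≤ t → t ≤ T → A t - A s = ∫ u in s..t, a u := by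
    intro s t h0 h1 h2
    rw [hA, hA, intervalIntegral.integral_interval_sub_left (haI le_rfl (h0.trans h1) h2)
      (haI le_rfl h0 (h1.trans h2))]
  have hτd : ∀ {s t : ℝ}, 0 ≤ s → s ≤ t → t ≤ T →
      τ t - τ s = 1 / 4 * ∫ u in s..t, S u * Real.exp (A u) := by
    intro s t h0 h1 h2
    rw [hτ, hτ, ← mul_sub, intervalIntegral.integral_interval_sub_left
      (hSeI le_rfl (h0.trans h1) h2) (hSeI le_rfl h0 (h1.trans h2))]
  have hAm : ∀ {s t : ℝ}, 0 ≤ s → s ≤ t → t ≤ T → A s ≤ A t := by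
    intro s t h0 h1 h2
    have := intervalIntegral.integral_nonneg (μ := volume) h1
      (fun u hu => ha0 u (h0.trans hu.1))
    linarith [hAd h0 h1 h2]
  have hτm : ∀ {s t : ℝ}, 0 ≤ s → s ≤ t → t ≤ T → τ s ≤ τ t := by
    intro s t h0 h1 h2
    have := intervalIntegral.integral_nonneg (μ := volume) (f := fun u => S u * Real.exp (A u)) h1
      (fun u hu => mul_nonneg (hS0 u (h0.trans hu.1)) (Real.exp_pos _).le)
    linarith [hτd h0 h1 h2]
  have hA0 : A 0 = 0 := by simp [hA]
  have hτ0 : τ 0 = 0 := by simp [hτ]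
  have hAmem : ∀ {s : ℝ}, s ∈ Icc 0 T → A s ∈ Icc 0 (A T) := fun {s} hs =>
    ⟨hA0 ▸ hAm le_rfl hs.1 hs.2, hAm hs.1 hs.2 le_rfl⟩
  have hτmem : ∀ {s : ℝ}, s ∈ Icc 0 T → τ s ∈ Icc 0 (τ T) := fun {s} hs =>
    ⟨hτ0 ▸ hτm le_rfl hs.1 hs.2, hτm hs.1 hs.2 le_rfl⟩
  have hconv : ∀ {p q v M : ℝ}, p ∈ Icc 0 M → q ∈ Icc 0 M → v ∈ Icc (0 : ℝ) 1 →
      p + v * (q - p) ∈ Icc 0 M := by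
    intro p q v M hp hq hv
    exact (convex_Icc 0 M).add_smul_sub_mem hp hq hv
  -- A point `(s, t, r, v)` records the two ends of a time step, an integration time within it, and
  -- a position on the segment joining the two curve points. `D₁` and `D₂` below are the errors of
  -- freezing the coefficients; they vanish at `(s, s, s, v)`, so uniform continuity makes them
  -- small for short steps.
  set box : Set (ℝ × ℝ × ℝ × ℝ) := Icc 0 T ×ˢ Icc 0 T ×ˢ Icc 0 T ×ˢ Icc 0 1 with hbox
  have hboxc : IsCompact box := isCompact_Icc.prod (isCompact_Icc.prod
    (isCompact_Icc.prod isCompact_Icc))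
  have c1 : ContinuousOn (fun q : ℝ × ℝ × ℝ × ℝ => A q.1) box :=
    hAc.comp continuousOn_fst fun q hq => hq.1
  have c2 : ContinuousOn (fun q : ℝ × ℝ × ℝ × ℝ => A q.2.1) box :=
    hAc.comp (by fun_prop) fun q hq => hq.2.1
  have c3 : ContinuousOn (fun q : ℝ × ℝ × ℝ × ℝ => A q.2.2.1) box :=
    hAc.comp (by fun_prop) fun q hq => hq.2.2.1
  have d1 : ContinuousOn (fun q : ℝ × ℝ × ℝ × ℝ => τ q.1) box :=
    hτc.comp continuousOn_fst fun q hq => hq.1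
  have d2 : ContinuousOn (fun q : ℝ × ℝ × ℝ × ℝ => τ q.2.1) box :=
    hτc.comp (by fun_prop) fun q hq => hq.2.1
  have hw : ContinuousOn (fun q : ℝ × ℝ × ℝ × ℝ => q.2.2.2) box := by fun_prop
  have e1 : ∀ k : ℝ → ℝ → ℝ → ℝ, ContinuousOn (fun q : ℝ × ℝ × ℝ => k q.1 q.2.1 q.2.2)
      (Icc 0 (A T) ×ˢ Icc 0 (τ T) ×ˢ Icc 0 T) →
      ContinuousOn (fun q : ℝ × ℝ × ℝ × ℝ => k (A q.1 + q.2.2.2 * (A q.2.1 - A q.1))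
        (τ q.1 + q.2.2.2 * (τ q.2.1 - τ q.1)) q.2.1) box := by
    intro k hk
    refine hk.comp (f := fun q : ℝ × ℝ × ℝ × ℝ => (A q.1 + q.2.2.2 * (A q.2.1 - A q.1),
        τ q.1 + q.2.2.2 * (τ q.2.1 - τ q.1), q.2.1))
      ((c1.add (hw.mul (c2.sub c1))).prodMk ((d1.add (hw.mul (d2.sub d1))).prodMk (by fun_prop)))
      fun q hq => ?_
    exact ⟨hconv (hAmem hq.1) (hAmem hq.2.1) hq.2.2.2,
      hconv (hτmem hq.1) (hτmem hq.2.1) hq.2.2.2, hq.2.1⟩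
  have e2 : ∀ k : ℝ → ℝ → ℝ → ℝ, ContinuousOn (fun q : ℝ × ℝ × ℝ => k q.1 q.2.1 q.2.2)
      (Icc 0 (A T) ×ˢ Icc 0 (τ T) ×ˢ Icc 0 T) →
      ContinuousOn (fun q : ℝ × ℝ × ℝ × ℝ => k (A q.1) (τ q.1) q.2.2.1) box := by
    intro k hk
    refine hk.comp (f := fun q : ℝ × ℝ × ℝ × ℝ => (A q.1, τ q.1, q.2.2.1))
      (c1.prodMk (d1.prodMk (by fun_prop)))
      fun q hq => ?_
    exact ⟨hAmem hq.1, hτmem hq.1, hq.2.2.1⟩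
  set D₁ : ℝ × ℝ × ℝ × ℝ → ℝ := fun q => k₁ (A q.1 + q.2.2.2 * (A q.2.1 - A q.1))
        (τ q.1 + q.2.2.2 * (τ q.2.1 - τ q.1)) q.2.1 - k₁ (A q.1) (τ q.1) q.2.2.1 with hD₁
  set D₂ : ℝ × ℝ × ℝ × ℝ → ℝ := fun q =>
      Real.exp (A q.2.2.1) / 4 * k₂ (A q.1 + q.2.2.2 * (A q.2.1 - A q.1))
        (τ q.1 + q.2.2.2 * (τ q.2.1 - τ q.1)) q.2.1 -
      Real.exp (A q.1) / 4 * k₂ (A q.1) (τ q.1) q.2.2.1 with hD₂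
  have u1 : UniformContinuousOn D₁ box :=
    hboxc.uniformContinuousOn_of_continuous ((e1 k₁ hk₁).sub (e2 k₁ hk₁))
  have u2 : UniformContinuousOn D₂ box := hboxc.uniformContinuousOn_of_continuous
    (((c3.rexp.div_const 4).mul (e1 k₂ hk₂)).sub ((c1.rexp.div_const 4).mul (e2 k₂ hk₂)))
  rw [Metric.uniformContinuousOn_iff] at u1 u2
  have hmain := eq_of_forall_abs_sub_le (F := fun t => Φ (A t) (τ t) t)
    (m := fun t => ∫ r in (0 : ℝ)..t, (a r + S r)) hT ?_
  · simpa only [hA0, hτ0] using hmain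
  intro ε hε
  obtain ⟨δ₁, hδ₁, h1⟩ := u1 ε hε
  obtain ⟨δ₂, hδ₂, h2⟩ := u2 ε hε
  refine ⟨min δ₁ δ₂, lt_min hδ₁ hδ₂, fun s t hs hst ht hd => ?_⟩
  have hsm : s ∈ Icc 0 T := ⟨hs, hst.trans ht⟩
  have htm : t ∈ Icc 0 T := ⟨hs.trans hst, ht⟩
  -- The increment of `Φ` is split at `(A s, τ s, t)`. The mean value theorem handles the spatial
  -- part, and `hΦ'` the part in `r`.
  obtain ⟨v, hv, hv'⟩ := exists_hasDerivAt_eq_slope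
    (fun v => Φ (A s + v * (A t - A s)) (τ s + v * (τ t - τ s)) t)
    (fun v => k₁ (A s + v * (A t - A s)) (τ s + v * (τ t - τ s)) t * (A t - A s) +
      k₂ (A s + v * (A t - A s)) (τ s + v * (τ t - τ s)) t * (τ t - τ s)) (zero_lt_one (α := ℝ))
    (fun v hv => (hΦ t htm _ _ _ _ v (hconv (hAmem hsm) (hAmem htm) hv)
      (hconv (hτmem hsm) (hτmem htm) hv)).continuousAt.continuousWithinAt)
    (fun v hv => hΦ t htm _ _ _ _ v (hconv (hAmem hsm) (hAmem htm) (Ioo_subset_Icc_self hv))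
      (hconv (hτmem hsm) (hτmem htm) (Ioo_subset_Icc_self hv)))
  have hv1 := Ioo_subset_Icc_self hv
  simp only [one_mul, zero_mul, add_zero, sub_zero, div_one, add_sub_cancel] at hv'
  set K₁ := k₁ (A s + v * (A t - A s)) (τ s + v * (τ t - τ s)) t
  set K₂ := k₂ (A s + v * (A t - A s)) (τ s + v * (τ t - τ s)) t
  have hr : ∀ k : ℝ → ℝ → ℝ → ℝ, ContinuousOn (fun q : ℝ × ℝ × ℝ => k q.1 q.2.1 q.2.2)
      (Icc 0 (A T) ×ˢ Icc 0 (τ T) ×ˢ Icc 0 T) →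
      ContinuousOn (fun r => k (A s) (τ s) r) (uIcc s t) := by
    intro k hk
    refine hk.comp (f := fun r : ℝ => (A s, τ s, r)) (by fun_prop) fun r hr => ?_
    rw [uIcc_of_le hst] at hr
    exact ⟨hAmem hsm, hτmem hsm, hs.trans hr.1, hr.2.trans ht⟩
  have i1 : IntervalIntegrable (fun r => a r * K₁) volume s t := (haI hs hst ht).mul_const _
  have i2 : IntervalIntegrable (fun r => S r * Real.exp (A r) * (K₂ / 4)) volume s t :=
    (hSeI hs hst ht).mul_const _
  have i3 : IntervalIntegrable (fun r => a r * k₁ (A s) (τ s) r +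
      S r * (Real.exp (A s) / 4 * k₂ (A s) (τ s) r)) volume s t :=
    ((haI hs hst ht).mul_continuousOn (hr k₁ hk₁)).add
      ((hSI hs hst ht).mul_continuousOn ((hr k₂ hk₂).const_smul (Real.exp (A s) / 4)))
  have hF : Φ (A t) (τ t) t - Φ (A s) (τ s) s =
      ∫ r in s..t, (a r * D₁ (s, t, r, v) + S r * D₂ (s, t, r, v)) := by
    have h3 := hΦ' (A s) (hAmem hsm) (τ s) (hτmem hsm) s t hs hst ht
    have h4 : ∫ r in s..t, (a r * D₁ (s, t, r, v) + S r * D₂ (s, t, r, v)) =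
        ∫ r in s..t, ((a r * K₁ + S r * Real.exp (A r) * (K₂ / 4)) -
          (a r * k₁ (A s) (τ s) r + S r * (Real.exp (A s) / 4 * k₂ (A s) (τ s) r))) := by
      refine intervalIntegral.integral_congr fun r _ => ?_
      simp only [hD₁, hD₂]
      ring
    rw [h4, intervalIntegral.integral_sub (i1.add i2) i3, intervalIntegral.integral_add i1 i2,
      intervalIntegral.integral_mul_const, intervalIntegral.integral_mul_const, ← hAd hs hst ht]
    have h5 := hτd hs hst ht
    linear_combination h3 - hv' + K₂ * h5
  have haS : IntervalIntegrable (fun r => a r + S r) volume s t :=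
    (haI hs hst ht).add (hSI hs hst ht)
  rw [hF, intervalIntegral.integral_interval_sub_left (f := fun r => a r + S r)
    ((haI le_rfl (hs.trans hst) ht).add (hSI le_rfl (hs.trans hst) ht))
    ((haI le_rfl hs hsm.2).add (hSI le_rfl hs hsm.2)),
    ← intervalIntegral.integral_const_mul, ← Real.norm_eq_abs]
  refine intervalIntegral.norm_integral_le_of_norm_le hst (ae_of_all _ fun r hr => ?_)
    (haS.const_mul ε)
  have hr0 : 0 ≤ r := hs.trans hr.1.le
  have hb : (s, t, r, v) ∈ box := ⟨hsm, htm, ⟨hr0, hr.2.trans ht⟩, hv1⟩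
  have hb' : (s, s, s, v) ∈ box := ⟨hsm, hsm, hsm, hv1⟩
  have hdist : dist (s, t, r, v) (s, s, s, v) < min δ₁ δ₂ := by
    have h6 : |t - s| < min δ₁ δ₂ := by rwa [abs_of_nonneg (by linarith)]
    have h7 : |r - s| < min δ₁ δ₂ := by
      rw [abs_of_nonneg (by linarith [hr.1])]
      linarith [hr.2]
    have h8 : (0 : ℝ) < min δ₁ δ₂ := lt_min hδ₁ hδ₂
    simp only [Prod.dist_eq, Real.dist_eq, sub_self, abs_zero]
    exact max_lt h8 (max_lt h6 (max_lt h7 h8))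
  have b1 := h1 _ hb _ hb' (hdist.trans_le (min_le_left _ _))
  have b2 := h2 _ hb _ hb' (hdist.trans_le (min_le_right _ _))
  have z1 : D₁ (s, s, s, v) = 0 := by simp [hD₁]
  have z2 : D₂ (s, s, s, v) = 0 := by simp [hD₂]
  rw [z1, Real.dist_eq, sub_zero] at b1
  rw [z2, Real.dist_eq, sub_zero] at b2
  have p1 := ha0 r hr0
  have p2 := hS0 r hr0
  calc ‖a r * D₁ (s, t, r, v) + S r * D₂ (s, t, r, v)‖
      ≤ a r * |D₁ (s, t, r, v)| + S r * |D₂ (s, t, r, v)| := by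
        refine (norm_add_le _ _).trans_eq ?_
        rw [norm_mul, norm_mul, Real.norm_of_nonneg p1, Real.norm_of_nonneg p2]
        rfl
    _ ≤ a r * ε + S r * ε := by gcongr
    _ = ε * (a r + S r) := by ring

/-! ### Dynkin's formula and Laplace moments of affine diffusions. -/

section SDE

variable {Ω : Type*} [mΩ : MeasurableSpace Ω] {P : Measure Ω} {𝓕 : Filtration ℝ≥0 mΩ}
  {b σ : ℝ → ℝ → ℝ} {X : ℝ≥0 → Ω → ℝ}

lemma IsNonnegSDESolution.measurable (hX : IsNonnegSDESolution P 𝓕 b σ X) (t : ℝ≥0) :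
    Measurable (X t) :=
  ((hX.adapted t).mono (𝓕.le t)).measurable

lemma IsNonnegSDESolution.measurable_uncurry (hX : IsNonnegSDESolution P 𝓕 b σ X) :
    Measurable fun p : Ω × ℝ => X p.2.toNNReal p.1 :=
  (measurable_uncurry_of_continuous_of_measurable hX.continuous_paths hX.measurable).comp
    (measurable_snd.real_toNNReal.prodMk measurable_fst)

lemma IsNonnegSDESolution.continuous_integral (hX : IsNonnegSDESolution P 𝓕 b σ X)
    (Q : Measure Ω) [IsFiniteMeasure Q] {u : ℝ → ℝ} (hu : Continuous u) {C : ℝ}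
    (hC : ∀ x, 0 ≤ x → |u x| ≤ C) :
    Continuous fun r : ℝ => ∫ ω, u (X r.toNNReal ω) ∂Q := by
  refine continuous_of_dominated (bound := fun _ => C) (fun r => ?_)
    (fun r => ae_of_all _ fun ω => hC _ (hX.nonneg _ _)) (integrable_const _)
    (ae_of_all _ fun ω => hu.comp ((hX.continuous_paths ω).comp continuous_real_toNNReal))
  exact (hu.measurable.comp (hX.measurable _)).aestronglyMeasurable

/-- The coefficients of `dX = ((ν + 1) / 2 * S(t) - a(t) X) dt + √(S(t) X) dW`. -/
structure IsAffineCoeff (ν : ℝ) (a S : ℝ → ℝ) (b σ : ℝ → ℝ → ℝ) : Prop where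
  drift : ∀ r, 0 ≤ r → ∀ x, 0 ≤ x → b r x = (ν + 1) / 2 * S r - a r * x
  diffusion : ∀ r, 0 ≤ r → ∀ x, 0 ≤ x → σ r x ^ 2 = S r * x
  intervalIntegrable_a : ∀ t, 0 ≤ t → IntervalIntegrable a volume 0 t
  intervalIntegrable_S : ∀ t, 0 ≤ t → IntervalIntegrable S volume 0 t
  a_nonneg : ∀ t, 0 ≤ t → 0 ≤ a t
  S_nonneg : ∀ t, 0 ≤ t → 0 ≤ S t

variable {ν : ℝ} {a S : ℝ → ℝ}

/-- The event `X 0 ⁻¹' B` lies in `𝓕 0`, so the martingale, which starts at zero, has integral zero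
over it; Fubini then exchanges time and expectation. Retaining `B` is what later yields the joint
law with `X 0`. -/
lemma IsNonnegSDESolution.dynkin [IsProbabilityMeasure P] (hX : IsNonnegSDESolution P 𝓕 b σ X)
    (hc : IsAffineCoeff ν a S b σ) {B : Set ℝ} (hB : MeasurableSet B) {f : ℝ → ℝ}
    (hf : ContDiff ℝ ((⊤ : ℕ∞) : WithTop ℕ∞) f) (hfc : HasCompactSupport f) (t : ℝ≥0) :
    ∫ ω, f (X t ω) ∂(P.restrict (X 0 ⁻¹' B)) - ∫ ω, f (X 0 ω) ∂(P.restrict (X 0 ⁻¹' B)) =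
      ∫ r in (0 : ℝ)..t,
        (S r * ∫ ω, ((ν + 1) / 2 * deriv f (X r.toNNReal ω) +
            X r.toNNReal ω / 2 * deriv (deriv f) (X r.toNNReal ω)) ∂(P.restrict (X 0 ⁻¹' B)) -
          a r * ∫ ω, X r.toNNReal ω * deriv f (X r.toNNReal ω) ∂(P.restrict (X 0 ⁻¹' B))) := by
  set Q := P.restrict (X 0 ⁻¹' B)
  have hf1 : Continuous (deriv f) := hf.continuous_deriv (by norm_num)
  have hf2 : Continuous (deriv (deriv f)) :=
    (contDiff_infty_iff_deriv.1 hf).2.continuous_deriv (by norm_num)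
  set u : ℝ → ℝ := fun x => (ν + 1) / 2 * deriv f x + x / 2 * deriv (deriv f) x with hu
  set v : ℝ → ℝ := fun x => x * deriv f x with hv
  have huc : Continuous u := by fun_prop
  have hvc : Continuous v := by fun_prop
  have hus : HasCompactSupport u := (hfc.deriv.mul_left).add (hfc.deriv.deriv.mul_left)
  have hvs : HasCompactSupport v := hfc.deriv.mul_left
  obtain ⟨Cu, hCu⟩ := hus.exists_bound_of_continuous huc
  obtain ⟨Cv, hCv⟩ := hvs.exists_bound_of_continuous hvc
  obtain ⟨Cf, hCf⟩ := hfc.exists_bound_of_continuous hf.continuous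
  have hgen : ∀ r, 0 ≤ r → ∀ ω, sdeGenerator b σ f r (X r.toNNReal ω) =
      S r * u (X r.toNNReal ω) - a r * v (X r.toNNReal ω) := by
    intro r hr ω
    rw [sdeGenerator, hc.drift r hr _ (hX.nonneg _ _), hc.diffusion r hr _ (hX.nonneg _ _),
      iteratedDeriv_succ, iteratedDeriv_one, hu, hv]
    ring
  have ht : (0 : ℝ) ≤ t := t.2
  have hint : Integrable (fun p : Ω × ℝ => S p.2 * u (X p.2.toNNReal p.1) -
      a p.2 * v (X p.2.toNNReal p.1)) (Q.prod (volume.restrict (Ioc 0 (t : ℝ)))) := by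
    have hSi := ((intervalIntegrable_iff_integrableOn_Ioc_of_le ht).1
      (hc.intervalIntegrable_S t ht)).integrable.comp_snd Q
    have hai := ((intervalIntegrable_iff_integrableOn_Ioc_of_le ht).1
      (hc.intervalIntegrable_a t ht)).integrable.comp_snd Q
    refine (hSi.mul_bdd (c := Cu) ?_ (ae_of_all _ fun p => hCu _)).sub
      (hai.mul_bdd (c := Cv) ?_ (ae_of_all _ fun p => hCv _))
    · exact (huc.measurable.comp hX.measurable_uncurry).aestronglyMeasurable
    · exact (hvc.measurable.comp hX.measurable_uncurry).aestronglyMeasurable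
  have hfi : ∀ s, Integrable (fun ω => f (X s ω)) Q := fun s =>
    Integrable.of_bound (hf.continuous.measurable.comp (hX.measurable s)).aestronglyMeasurable Cf
      (ae_of_all _ fun ω => hCf _)
  have hM := (hX.martingale f hf hfc).setIntegral_eq (zero_le (a := t))
    ((hX.adapted 0).measurable hB)
  simp only [NNReal.coe_zero, intervalIntegral.integral_same, sub_self,
    integral_zero] at hM
  have hinner : ∀ ω, ∫ r in (0 : ℝ)..t, sdeGenerator b σ f r (X r.toNNReal ω) =
      ∫ r in Ioc 0 (t : ℝ), (S r * u (X r.toNNReal ω) - a r * v (X r.toNNReal ω)) := by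
    intro ω
    rw [intervalIntegral.integral_of_le ht]
    exact setIntegral_congr_fun measurableSet_Ioc fun r hr => hgen r hr.1.le ω
  simp only [hinner] at hM
  have hM' := hM.trans ((integral_sub ((hfi t).sub (hfi 0)) hint.integral_prod_left).trans
    (congrArg₂ (· - ·) (integral_sub (hfi t) (hfi 0)) (integral_integral_swap hint)))
  rw [intervalIntegral.integral_of_le ht, sub_eq_zero.1 hM'.symm]
  refine setIntegral_congr_fun measurableSet_Ioc fun r _ => ?_
  have hui : Integrable (fun ω => u (X r.toNNReal ω)) Q :=
    Integrable.of_bound (huc.measurable.comp (hX.measurable _)).aestronglyMeasurable Cu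
      (ae_of_all _ fun ω => hCu _)
  have hvi : Integrable (fun ω => v (X r.toNNReal ω)) Q :=
    Integrable.of_bound (hvc.measurable.comp (hX.measurable _)).aestronglyMeasurable Cv
      (ae_of_all _ fun ω => hCv _)
  simp only
  rw [integral_sub (hui.const_mul _) (hvi.const_mul _), integral_const_mul, integral_const_mul]

/-- `E[X_rʲ e^{-l X_r}]`, under the finite measure `Q`. -/
noncomputable def laplaceMoment (Q : Measure Ω) (X : ℝ≥0 → Ω → ℝ) (j : ℕ) (l r : ℝ) : ℝ :=
  ∫ ω, X r.toNNReal ω ^ j * Real.exp (-(l * X r.toNNReal ω)) ∂Q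

lemma pow_mul_exp_neg_le (j : ℕ) {l x : ℝ} (hl : 0 < l) (hx : 0 ≤ x) :
    x ^ j * Real.exp (-(l * x)) ≤ (Nat.factorial j) / l ^ j := by
  have h := Real.pow_div_factorial_le_exp (l * x) (by positivity) j
  rw [Real.exp_neg, le_div_iff₀ (by positivity), mul_right_comm, ← div_eq_mul_inv,
    div_le_iff₀ (Real.exp_pos _)]
  rw [div_le_iff₀ (by positivity), mul_pow] at h
  linarith

lemma norm_pow_mul_exp_neg_le (j : ℕ) {l x : ℝ} (hl : 0 < l) (hx : 0 ≤ x) :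
    ‖x ^ j * Real.exp (-(l * x))‖ ≤ (Nat.factorial j) / l ^ j := by
  rw [Real.norm_of_nonneg (mul_nonneg (pow_nonneg hx j) (Real.exp_pos _).le)]
  exact pow_mul_exp_neg_le j hl hx

lemma IsNonnegSDESolution.aestronglyMeasurable_laplace (hX : IsNonnegSDESolution P 𝓕 b σ X)
    (Q : Measure Ω) (j : ℕ) (l r : ℝ) :
    AEStronglyMeasurable (fun ω => X r.toNNReal ω ^ j * Real.exp (-(l * X r.toNNReal ω))) Q := by
  have := hX.measurable r.toNNReal
  exact Measurable.aestronglyMeasurable (by fun_prop)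

lemma IsNonnegSDESolution.integrable_laplace (hX : IsNonnegSDESolution P 𝓕 b σ X)
    (Q : Measure Ω) [IsFiniteMeasure Q] (j : ℕ) {l : ℝ} (hl : 0 < l) (r : ℝ) :
    Integrable (fun ω => X r.toNNReal ω ^ j * Real.exp (-(l * X r.toNNReal ω))) Q :=
  Integrable.of_bound (hX.aestronglyMeasurable_laplace Q j l r) _
    (ae_of_all _ fun ω => norm_pow_mul_exp_neg_le j hl (hX.nonneg _ ω))

/-- Near a given `l > 0` the integrands are bounded by the constant belonging to `l / 2`, so path
continuity passes to the expectation jointly in both variables. -/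
lemma IsNonnegSDESolution.continuousOn_laplaceMoment (hX : IsNonnegSDESolution P 𝓕 b σ X)
    (Q : Measure Ω) [IsFiniteMeasure Q] (j : ℕ) :
    ContinuousOn (fun q : ℝ × ℝ => laplaceMoment Q X j q.1 q.2) (Ioi 0 ×ˢ univ) := by
  rintro ⟨l, r⟩ ⟨hl, -⟩
  have hl : 0 < l := hl
  refine ContinuousAt.continuousWithinAt (continuousAt_of_dominated
    (bound := fun _ => (Nat.factorial j) / (l / 2) ^ j)
    (Eventually.of_forall fun q => hX.aestronglyMeasurable_laplace Q j _ _) ?_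
    (integrable_const _) (ae_of_all _ fun ω => ?_))
  · have h : ∀ᶠ q : ℝ × ℝ in 𝓝 (l, r), l / 2 < q.1 :=
      continuousAt_fst.eventually (lt_mem_nhds (half_lt_self hl))
    filter_upwards [h] with q hq
    refine ae_of_all _ fun ω => (norm_pow_mul_exp_neg_le j (by linarith) (hX.nonneg _ ω)).trans ?_
    gcongr
  · have := (hX.continuous_paths ω).comp (continuous_real_toNNReal.comp (continuous_snd (X := ℝ)))
    simp only [Function.comp_def] at this
    exact ((this.pow j).mul (continuous_fst.mul this).neg.rexp).continuousAt

lemma IsNonnegSDESolution.hasDerivAt_laplaceMoment (hX : IsNonnegSDESolution P 𝓕 b σ X)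
    (Q : Measure Ω) [IsFiniteMeasure Q] (j : ℕ) {l : ℝ} (hl : 0 < l) (r : ℝ) :
    HasDerivAt (fun l => laplaceMoment Q X j l r) (-laplaceMoment Q X (j + 1) l r) l := by
  have h := hasDerivAt_integral_of_dominated_loc_of_deriv_le (μ := Q) (s := Ioi (l / 2)) (x₀ := l)
    (bound := fun _ => (Nat.factorial (j + 1)) / (l / 2) ^ (j + 1))
    (F := fun l ω => X r.toNNReal ω ^ j * Real.exp (-(l * X r.toNNReal ω)))
    (F' := fun l ω => -(X r.toNNReal ω ^ (j + 1) * Real.exp (-(l * X r.toNNReal ω))))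
    (Ioi_mem_nhds (half_lt_self hl))
    (Eventually.of_forall fun l => hX.aestronglyMeasurable_laplace Q j l r)
    (hX.integrable_laplace Q j hl r) (hX.aestronglyMeasurable_laplace Q (j + 1) l r).neg ?_
    (integrable_const _) ?_
  · rw [laplaceMoment, ← integral_neg]
    exact h.2
  · refine ae_of_all _ fun ω x hx => ?_
    have hx : l / 2 < x := hx
    rw [norm_neg]
    refine (norm_pow_mul_exp_neg_le (j + 1) (by linarith) (hX.nonneg _ ω)).trans ?_
    gcongr
  · refine ae_of_all _ fun ω x _ => ?_
    have h1 : HasDerivAt (fun l => -(l * X r.toNNReal ω)) (-(X r.toNNReal ω)) x := by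
      simpa using ((hasDerivAt_id x).mul_const (X r.toNNReal ω)).fun_neg
    convert! h1.exp.const_mul (X r.toNNReal ω ^ j) using 1
    ring

end SDE

/-! ### From compactly supported test functions to exponentials. -/

/-- The exponential `x ↦ e^{-lx}` is, on `[0, ∞)`, a limit of test functions, with the control
needed for passing to the limit in a generator with affine coefficients. -/
lemma exists_testFunction_tendsto_exp {l : ℝ} (hl : 0 < l) :
    ∃ (f : ℕ → ℝ → ℝ) (C : ℝ),
      (∀ n, ContDiff ℝ ((⊤ : ℕ∞) : WithTop ℕ∞) (f n)) ∧ (∀ n, HasCompactSupport (f n)) ∧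
      (∀ n x, 0 ≤ x → |f n x| ≤ C ∧ |deriv (f n) x| ≤ C ∧ |x * deriv (f n) x| ≤ C ∧
        |x * deriv (deriv (f n)) x| ≤ C) ∧
      ∀ x, Tendsto (fun n => f n x) atTop (𝓝 (Real.exp (-(l * x)))) ∧
        Tendsto (fun n => deriv (f n) x) atTop (𝓝 (Real.exp (-(l * x)) * (-l))) ∧
        Tendsto (fun n => deriv (deriv (f n)) x) atTop (𝓝 (Real.exp (-(l * x)) * l ^ 2)) := by
  obtain ⟨χ⟩ : Nonempty (ContDiffBump (0 : ℝ)) := inferInstance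
  have hχ : ContDiff ℝ ((⊤ : ℕ∞) : WithTop ℕ∞) (χ : ℝ → ℝ) := χ.contDiff
  have hχ' := (contDiff_infty_iff_deriv.1 hχ).2
  have hχ'' := (contDiff_infty_iff_deriv.1 hχ').2
  have hχs : HasCompactSupport (χ : ℝ → ℝ) := χ.hasCompactSupport
  obtain ⟨C₀, hC₀⟩ := hχs.exists_bound_of_continuous hχ.continuous
  obtain ⟨C₁, hC₁⟩ := hχs.deriv.exists_bound_of_continuous hχ'.continuous
  obtain ⟨C₂, hC₂⟩ := hχs.deriv.deriv.exists_bound_of_continuous hχ''.continuous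
  have hC₀0 := (norm_nonneg _).trans (hC₀ 0)
  have hC₁0 := (norm_nonneg _).trans (hC₁ 0)
  have hC₂0 := (norm_nonneg _).trans (hC₂ 0)
  simp only [Real.norm_eq_abs] at hC₀ hC₁ hC₂
  have hdχ : ∀ x, HasDerivAt (χ : ℝ → ℝ) (deriv χ x) x := fun x =>
    ((hχ.differentiable (by norm_num)) x).hasDerivAt
  have hdχ' : ∀ x, HasDerivAt (deriv (χ : ℝ → ℝ)) (deriv (deriv χ) x) x := fun x =>
    ((hχ'.differentiable (by norm_num)) x).hasDerivAt
  -- The cutoff is `χ (ε n * x)`: each derivative of it gains a factor `ε n ≤ 1`, so the bounds are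
  -- uniform in `n`.
  set ε : ℕ → ℝ := fun n => 1 / ((n : ℝ) + 1) with hε
  have hε0 : ∀ n, 0 < ε n := fun n => by simp only [hε]; positivity
  have hε1 : ∀ n, ε n ≤ 1 := fun n => by
    simp only [hε]
    rw [div_le_one (by positivity)]
    have : (0 : ℝ) ≤ n := Nat.cast_nonneg n
    linarith
  have hεt : Tendsto ε atTop (𝓝 0) := tendsto_one_div_add_atTop_nhds_zero_nat
  have hexp : ∀ x : ℝ, HasDerivAt (fun x => Real.exp (-(l * x))) (Real.exp (-(l * x)) * (-l)) x := by
    intro x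
    have : HasDerivAt (fun x => -(l * x)) (-l) x := by
      simpa using ((hasDerivAt_id x).const_mul l).fun_neg
    exact this.exp
  have hlin : ∀ n x, HasDerivAt (fun x => ε n * x) (ε n) x := fun n x => by
    simpa using (hasDerivAt_id x).const_mul (ε n)
  have d1 : ∀ n x, HasDerivAt (fun x => Real.exp (-(l * x)) * χ (ε n * x))
      (Real.exp (-(l * x)) * (ε n * deriv χ (ε n * x) - l * χ (ε n * x))) x := by
    intro n x
    convert! (hexp x).mul ((hdχ (ε n * x)).comp x (hlin n x)) using 1
    simp only [Function.comp_apply]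
    ring
  have d2 : ∀ n x, HasDerivAt
      (fun x => Real.exp (-(l * x)) * (ε n * deriv χ (ε n * x) - l * χ (ε n * x)))
      (Real.exp (-(l * x)) * (ε n ^ 2 * deriv (deriv χ) (ε n * x) -
        2 * l * ε n * deriv χ (ε n * x) + l ^ 2 * χ (ε n * x))) x := by
    intro n x
    convert! (hexp x).mul ((((hdχ' (ε n * x)).comp x (hlin n x)).const_mul (ε n)).sub
      (((hdχ (ε n * x)).comp x (hlin n x)).const_mul l)) using 1
    simp only [Function.comp_apply, Pi.sub_apply]
    ring
  have e1 : ∀ n, deriv (fun x => Real.exp (-(l * x)) * χ (ε n * x)) =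
      fun x => Real.exp (-(l * x)) * (ε n * deriv χ (ε n * x) - l * χ (ε n * x)) :=
    fun n => funext fun x => (d1 n x).deriv
  have e2 : ∀ n, deriv (deriv (fun x => Real.exp (-(l * x)) * χ (ε n * x))) =
      fun x => Real.exp (-(l * x)) * (ε n ^ 2 * deriv (deriv χ) (ε n * x) -
        2 * l * ε n * deriv χ (ε n * x) + l ^ 2 * χ (ε n * x)) :=
    fun n => by rw [e1]; exact funext fun x => (d2 n x).deriv
  set K := C₂ + 2 * l * C₁ + l ^ 2 * C₀ + C₁ + l * C₀ + C₀ with hK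
  have hK0 : 0 ≤ K := by positivity
  have b0 : ∀ y, |χ y| ≤ K := fun y => (hC₀ y).trans (by
    have : 0 ≤ C₂ + 2 * l * C₁ + l ^ 2 * C₀ + C₁ + l * C₀ := by positivity
    linarith)
  have b1 : ∀ n y, |ε n * deriv χ y - l * χ y| ≤ K := by
    intro n y
    calc |ε n * deriv χ y - l * χ y| ≤ |ε n * deriv χ y| + |l * χ y| := abs_sub _ _
      _ = ε n * |deriv χ y| + l * |χ y| := by
        rw [abs_mul, abs_mul, abs_of_pos (hε0 n), abs_of_pos hl]
      _ ≤ 1 * C₁ + l * C₀ := by gcongr; exacts [hε1 n, hC₁ y, hC₀ y]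
      _ ≤ K := by
        have : 0 ≤ C₂ + 2 * l * C₁ + l ^ 2 * C₀ + C₀ := by positivity
        linarith
  have b2 : ∀ n y, |ε n ^ 2 * deriv (deriv χ) y - 2 * l * ε n * deriv χ y + l ^ 2 * χ y| ≤ K := by
    intro n y
    calc |ε n ^ 2 * deriv (deriv χ) y - 2 * l * ε n * deriv χ y + l ^ 2 * χ y|
        ≤ |ε n ^ 2 * deriv (deriv χ) y| + |2 * l * ε n * deriv χ y| + |l ^ 2 * χ y| :=
          (abs_add_le _ _).trans (add_le_add_left (abs_sub _ _) _)
      _ = ε n ^ 2 * |deriv (deriv χ) y| + 2 * l * ε n * |deriv χ y| + l ^ 2 * |χ y| := by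
        have h1 := hε0 n
        rw [abs_mul (ε n ^ 2), abs_mul (2 * l * ε n), abs_mul (l ^ 2),
          abs_of_pos (by positivity : 0 < ε n ^ 2),
          abs_of_pos (by positivity : 0 < 2 * l * ε n), abs_of_pos (by positivity : 0 < l ^ 2)]
      _ ≤ 1 ^ 2 * C₂ + 2 * l * 1 * C₁ + l ^ 2 * C₀ := by
        have h1 := (hε0 n).le
        have h2 := hε1 n
        gcongr
        exacts [hC₂ y, hC₁ y, hC₀ y]
      _ ≤ K := by
        have : 0 ≤ C₁ + l * C₀ + C₀ := by positivity
        linarith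
  -- The summand `1` comes from `e^{-lx} ≤ 1`, and `1 / l` from `x e^{-lx} ≤ 1 / l`.
  refine ⟨fun n x => Real.exp (-(l * x)) * χ (ε n * x), K * (1 + 1 / l), fun n => ?_, fun n => ?_,
    fun n x hx => ?_, fun x => ?_⟩
  · have := hχ.comp (contDiff_const.mul contDiff_id : ContDiff ℝ _ fun x : ℝ => ε n * x)
    exact ((contDiff_const.mul contDiff_id).neg.exp).mul this
  · refine HasCompactSupport.mul_left ?_
    exact hχs.comp_homeomorph (Homeomorph.mulLeft₀ (ε n) (hε0 n).ne')
  · have hE1 : |Real.exp (-(l * x))| ≤ 1 := by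
      rw [abs_of_pos (Real.exp_pos _), Real.exp_le_one_iff]
      have := mul_nonneg hl.le hx
      linarith
    have hE2 : |x * Real.exp (-(l * x))| ≤ 1 / l := by
      simpa using norm_pow_mul_exp_neg_le 1 hl hx
    have hKl : 0 ≤ K * (1 / l) := by positivity
    have hA : ∀ w, |w| ≤ K → |Real.exp (-(l * x)) * w| ≤ K * (1 + 1 / l) := by
      intro w hw
      rw [abs_mul]
      calc _ ≤ 1 * K := by gcongr
        _ ≤ _ := by linarith
    have hB : ∀ w, |w| ≤ K → |x * (Real.exp (-(l * x)) * w)| ≤ K * (1 + 1 / l) := by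
      intro w hw
      rw [← mul_assoc, abs_mul]
      calc _ ≤ 1 / l * K := by gcongr
        _ ≤ _ := by linarith
    rw [e2, e1]
    exact ⟨hA _ (b0 _), hA _ (b1 _ _), hB _ (b1 _ _), hB _ (b2 _ _)⟩
  · have hεx : Tendsto (fun n => ε n * x) atTop (𝓝 0) := by simpa using hεt.mul_const x
    have t0 : Tendsto (fun n => χ (ε n * x)) atTop (𝓝 1) := by
      have := (hχ.continuous.tendsto 0).comp hεx
      rwa [χ.one_of_mem_closedBall (Metric.mem_closedBall_self χ.rIn_pos.le)] at this
    have t1 := ((hχ'.continuous.tendsto 0).comp hεx)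
    have t2 := ((hχ''.continuous.tendsto 0).comp hεx)
    refine ⟨?_, ?_, ?_⟩
    · simpa using t0.const_mul (Real.exp (-(l * x)))
    · simp only [e1]
      simpa using ((hεt.mul t1).sub (t0.const_mul l)).const_mul (Real.exp (-(l * x)))
    · simp only [e2]
      simpa using ((((hεt.pow 2).mul t2).sub ((hεt.const_mul (2 * l)).mul t1)).add
        (t0.const_mul (l ^ 2))).const_mul (Real.exp (-(l * x)))

section SDE

variable {Ω : Type*} [mΩ : MeasurableSpace Ω] {P : Measure Ω} {𝓕 : Filtration ℝ≥0 mΩ}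
  {b σ : ℝ → ℝ → ℝ} {X : ℝ≥0 → Ω → ℝ} {ν : ℝ} {a S : ℝ → ℝ}

/-- Dominated convergence in `IsNonnegSDESolution.dynkin`, first in the expectations, then in time.
The moment of order one is minus the `l`-derivative of that of order zero, so this is a transport
equation in integrated form. -/
lemma IsNonnegSDESolution.laplaceMoment_sub_zero [IsProbabilityMeasure P]
    (hX : IsNonnegSDESolution P 𝓕 b σ X) (hc : IsAffineCoeff ν a S b σ) {B : Set ℝ}
    (hB : MeasurableSet B) {l : ℝ} (hl : 0 < l) {t : ℝ} (ht : 0 ≤ t) :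
    laplaceMoment (P.restrict (X 0 ⁻¹' B)) X 0 l t - laplaceMoment (P.restrict (X 0 ⁻¹' B)) X 0 l 0 =
      ∫ r in (0 : ℝ)..t,
        (S r * (-(ν + 1) / 2 * l * laplaceMoment (P.restrict (X 0 ⁻¹' B)) X 0 l r +
            l ^ 2 / 2 * laplaceMoment (P.restrict (X 0 ⁻¹' B)) X 1 l r) -
          a r * (-l * laplaceMoment (P.restrict (X 0 ⁻¹' B)) X 1 l r)) := by
  set Q := P.restrict (X 0 ⁻¹' B)
  obtain ⟨f, C, hf, hfc, hC, hlim⟩ := exists_testFunction_tendsto_exp hl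
  have hf1 : ∀ n, Continuous (deriv (f n)) := fun n => (hf n).continuous_deriv (by norm_num)
  have hf2 : ∀ n, Continuous (deriv (deriv (f n))) := fun n =>
    (contDiff_infty_iff_deriv.1 (hf n)).2.continuous_deriv (by norm_num)
  have hm : ∀ {g : ℝ → ℝ}, Continuous g → ∀ r : ℝ,
      AEStronglyMeasurable (fun ω => g (X r.toNNReal ω)) Q := fun hg r =>
    (hg.measurable.comp (hX.measurable _)).aestronglyMeasurable
  set u : ℕ → ℝ → ℝ := fun n x => (ν + 1) / 2 * deriv (f n) x + x / 2 * deriv (deriv (f n)) x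
    with hu
  set v : ℕ → ℝ → ℝ := fun n x => x * deriv (f n) x with hv
  have huc : ∀ n, Continuous (u n) := fun n => by
    have := hf1 n
    have := hf2 n
    fun_prop
  have hvc : ∀ n, Continuous (v n) := fun n => by
    have := hf1 n
    fun_prop
  have hub : ∀ n x, 0 ≤ x → |u n x| ≤ |(ν + 1) / 2| * C + 1 / 2 * C := by
    intro n x hx
    obtain ⟨-, h1, -, h2⟩ := hC n x hx
    calc |u n x| ≤ |(ν + 1) / 2 * deriv (f n) x| + |x / 2 * deriv (deriv (f n)) x| :=
          abs_add_le _ _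
      _ = |(ν + 1) / 2| * |deriv (f n) x| + 1 / 2 * |x * deriv (deriv (f n)) x| := by
        rw [abs_mul, show x / 2 * deriv (deriv (f n)) x = 1 / 2 * (x * deriv (deriv (f n)) x) by
          ring, abs_mul (1 / 2), abs_of_pos (by norm_num : (0 : ℝ) < 1 / 2)]
      _ ≤ _ := by gcongr
  have hvb : ∀ n x, 0 ≤ x → |v n x| ≤ C := fun n x hx => (hC n x hx).2.2.1
  have hut : ∀ r, Tendsto (fun n => ∫ ω, u n (X r.toNNReal ω) ∂Q) atTop
      (𝓝 (-(ν + 1) / 2 * l * laplaceMoment Q X 0 l r + l ^ 2 / 2 * laplaceMoment Q X 1 l r)) := by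
    intro r
    rw [laplaceMoment, laplaceMoment, ← integral_const_mul, ← integral_const_mul,
      ← integral_add ((hX.integrable_laplace Q 0 hl r).const_mul _)
        ((hX.integrable_laplace Q 1 hl r).const_mul _)]
    refine tendsto_integral_of_dominated_convergence _ (fun n => hm (huc n) r) (integrable_const _)
      (fun n => ae_of_all _ fun ω => hub n _ (hX.nonneg _ _)) (ae_of_all _ fun ω => ?_)
    obtain ⟨-, h1, h2⟩ := hlim (X r.toNNReal ω)
    convert (h1.const_mul ((ν + 1) / 2)).add (h2.const_mul (X r.toNNReal ω / 2)) using 2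
    ring
  have hvt : ∀ r, Tendsto (fun n => ∫ ω, v n (X r.toNNReal ω) ∂Q) atTop
      (𝓝 (-l * laplaceMoment Q X 1 l r)) := by
    intro r
    rw [laplaceMoment, ← integral_const_mul]
    refine tendsto_integral_of_dominated_convergence _ (fun n => hm (hvc n) r) (integrable_const _)
      (fun n => ae_of_all _ fun ω => hvb n _ (hX.nonneg _ _)) (ae_of_all _ fun ω => ?_)
    obtain ⟨-, h1, -⟩ := hlim (X r.toNNReal ω)
    convert h1.const_mul (X r.toNNReal ω) using 2
    ring
  have hft : ∀ r : ℝ, Tendsto (fun n => ∫ ω, f n (X r.toNNReal ω) ∂Q) atTop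
      (𝓝 (laplaceMoment Q X 0 l r)) := by
    intro r
    refine tendsto_integral_of_dominated_convergence _ (fun n => hm (hf n).continuous r)
      (integrable_const C) (fun n => ae_of_all _ fun ω => (hC n _ (hX.nonneg _ _)).1)
      (ae_of_all _ fun ω => ?_)
    simpa using (hlim (X r.toNNReal ω)).1
  have hSI := hc.intervalIntegrable_S t ht
  have haI := hc.intervalIntegrable_a t ht
  have hucont := fun n => hX.continuous_integral Q (huc n) (hub n)
  have hvcont := fun n => hX.continuous_integral Q (hvc n) (hvb n)
  have hbound : ∀ {g : ℝ → ℝ} {D : ℝ}, (∀ x, 0 ≤ x → |g x| ≤ D) → ∀ r : ℝ,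
      |∫ ω, g (X r.toNNReal ω) ∂Q| ≤ D * Q.real univ := by
    intro g D hg r
    rw [← Real.norm_eq_abs]
    exact norm_integral_le_of_norm_le_const (ae_of_all _ fun ω => hg _ (hX.nonneg _ ω))
  have key : ∀ n, ∫ ω, f n (X t.toNNReal ω) ∂Q - ∫ ω, f n (X (0 : ℝ).toNNReal ω) ∂Q =
      ∫ r in (0 : ℝ)..t, (S r * ∫ ω, u n (X r.toNNReal ω) ∂Q -
        a r * ∫ ω, v n (X r.toNNReal ω) ∂Q) := by
    intro n
    have := hX.dynkin hc hB (hf n) (hfc n) t.toNNReal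
    rw [Real.coe_toNNReal t ht] at this
    rw [Real.toNNReal_zero]
    exact this
  refine tendsto_nhds_unique (((hft t).sub (hft 0)).congr key)
    (intervalIntegral.tendsto_integral_filter_of_dominated_convergence
      (fun r => S r * ((|(ν + 1) / 2| * C + 1 / 2 * C) * Q.real univ) + a r * (C * Q.real univ))
      (Eventually.of_forall fun n => ?_) (Eventually.of_forall fun n => ?_)
      ((hSI.mul_const _).add (haI.mul_const _)) (ae_of_all _ fun r _ => ?_))
  · have h1 := hSI.mul_continuousOn (hucont n).continuousOn
    have h2 := haI.mul_continuousOn (hvcont n).continuousOn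
    exact (h1.sub h2).aestronglyMeasurable_restrict_uIoc
  · refine ae_of_all _ fun r hr => ?_
    rw [uIoc_of_le ht] at hr
    have p1 := hc.S_nonneg r hr.1.le
    have p2 := hc.a_nonneg r hr.1.le
    refine (norm_sub_le _ _).trans ?_
    rw [norm_mul, norm_mul, Real.norm_of_nonneg p1, Real.norm_of_nonneg p2]
    gcongr
    · exact hbound (hub n) r
    · exact hbound (hvb n) r
  · exact ((hut r).const_mul _).sub ((hvt r).const_mul _)

end SDE

/-! ### Solving the transport equation by characteristics. -/

section SDE

variable {Ω : Type*} [mΩ : MeasurableSpace Ω] {P : Measure Ω} {𝓕 : Filtration ℝ≥0 mΩ}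
  {b σ : ℝ → ℝ → ℝ} {X : ℝ≥0 → Ω → ℝ} {ν : ℝ} {a S : ℝ → ℝ}

/-- The Laplace transform of `e^{A(t)} X_t` on an event of the initial σ-algebra `σ(X_0)`. -/
lemma IsNonnegSDESolution.laplaceMoment_eq [IsProbabilityMeasure P]
    (hX : IsNonnegSDESolution P 𝓕 b σ X) (hc : IsAffineCoeff ν a S b σ) {B : Set ℝ}
    (hB : MeasurableSet B) {l : ℝ} (hl : 0 < l) {t : ℝ} (ht : 0 ≤ t) {A τ : ℝ → ℝ}
    (hA : ∀ r, A r = ∫ u in (0 : ℝ)..r, a u)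
    (hτ : ∀ r, τ r = 1 / 4 * ∫ u in (0 : ℝ)..r, S u * Real.exp (A u)) (hτt : 0 ≤ τ t) :
    laplaceMoment (P.restrict (X 0 ⁻¹' B)) X 0 (l * Real.exp (A t)) t =
      (1 + 2 * τ t * l) ^ (-(ν + 1)) *
        laplaceMoment (P.restrict (X 0 ⁻¹' B)) X 0 (l / (1 + 2 * τ t * l)) 0 := by
  set Q := P.restrict (X 0 ⁻¹' B)
  -- The solution of `θ' = 2 θ²` with end value `l` at `τ t`; its value at `0` is the argument `l /
  -- (1 + 2 τ l)` of the initial transform.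
  set θ : ℝ → ℝ := fun y => l / (1 + 2 * l * (τ t - y)) with hθ
  have hD : ∀ y ∈ Icc 0 (τ t), 0 < 1 + 2 * l * (τ t - y) := fun y hy => by
    have : 0 ≤ τ t - y := by linarith [hy.2]
    positivity
  have hθ0 : ∀ y ∈ Icc 0 (τ t), 0 < θ y := fun y hy => div_pos hl (hD y hy)
  have hθc : ContinuousOn θ (Icc 0 (τ t)) :=
    ContinuousOn.div (by fun_prop) (by fun_prop) fun y hy => (hD y hy).ne'
  have hθd : ∀ y ∈ Icc 0 (τ t), HasDerivAt θ (2 * θ y ^ 2) y := by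
    intro y hy
    have h1 : HasDerivAt (fun y => 1 + 2 * l * (τ t - y)) (-(2 * l)) y := by
      simpa using (((hasDerivAt_id y).const_sub (τ t)).const_mul (2 * l)).const_add 1
    convert! (hasDerivAt_const y l).div h1 (hD y hy).ne' using 1
    simp only [hθ]
    have := (hD y hy).ne'
    field_simp
    ring
  set box : Set (ℝ × ℝ × ℝ) := Icc 0 (A t) ×ˢ Icc 0 (τ t) ×ˢ Icc 0 t with hbox
  have cθ : ContinuousOn (fun q : ℝ × ℝ × ℝ => θ q.2.1) box :=
    hθc.comp (by fun_prop) fun q hq => hq.2.1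
  have ce : ContinuousOn (fun q : ℝ × ℝ × ℝ => Real.exp q.1) box := by fun_prop
  have cp : ContinuousOn (fun q : ℝ × ℝ × ℝ => θ q.2.1 ^ (ν + 1)) box :=
    cθ.rpow_const fun q hq => Or.inl (hθ0 _ hq.2.1).ne'
  have cM : ∀ j, ContinuousOn (fun q : ℝ × ℝ × ℝ =>
      laplaceMoment Q X j (θ q.2.1 * Real.exp q.1) q.2.2) box := fun j =>
    (hX.continuousOn_laplaceMoment Q j).comp
      (f := fun q : ℝ × ℝ × ℝ => (θ q.2.1 * Real.exp q.1, q.2.2))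
      ((cθ.mul ce).prodMk (by fun_prop))
      fun q hq => ⟨mul_pos (hθ0 _ hq.2.1) (Real.exp_pos _), mem_univ _⟩
  -- The prefactor `θ ^ (ν + 1)` is the integrating factor cancelling the zeroth-order term `-(ν +
  -- 1) / 2 * S * λ * M`. Its ratio between the two ends produces `(1 + 2 τ l) ^ (-(ν + 1))`.
  have h := eq_along_curve (T := t) ht hc.a_nonneg hc.S_nonneg (hc.intervalIntegrable_a t ht)
    (hc.intervalIntegrable_S t ht) hA hτ
    (Φ := fun x y r => θ y ^ (ν + 1) * laplaceMoment Q X 0 (θ y * Real.exp x) r)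
    (k₁ := fun x y r => -(θ y ^ (ν + 1) * (θ y * Real.exp x) *
      laplaceMoment Q X 1 (θ y * Real.exp x) r))
    (k₂ := fun x y r => θ y ^ (ν + 1) * θ y * (2 * (ν + 1)) *
        laplaceMoment Q X 0 (θ y * Real.exp x) r -
      θ y ^ (ν + 1) * (2 * θ y ^ 2 * Real.exp x) * laplaceMoment Q X 1 (θ y * Real.exp x) r)
    ((cp.mul (cθ.mul ce)).mul (cM 1)).neg
    ((((cp.mul cθ).mul continuousOn_const).mul (cM 0)).sub
      ((cp.mul ((continuousOn_const.mul (cθ.pow 2)).mul ce)).mul (cM 1))) ?_ ?_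
  · have e1 : θ (τ t) = l := by simp [hθ]
    have e2 : θ 0 = l / (1 + 2 * τ t * l) := by simp only [hθ]; congr 1; ring
    simp only [e1, e2, Real.exp_zero, mul_one] at h
    have hD0 : 0 < 1 + 2 * τ t * l := by positivity
    rw [Real.div_rpow hl.le hD0.le] at h
    have hlp : l ^ (ν + 1) ≠ 0 := (Real.rpow_pos_of_pos hl _).ne'
    rw [Real.rpow_neg hD0.le]
    refine mul_left_cancel₀ hlp (h.trans ?_)
    rw [div_eq_mul_inv]
    ring
  · intro r _ x x' y y' v _ hy
    have h1 : HasDerivAt (fun v => x + v * x') x' v := by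
      simpa using ((hasDerivAt_id v).mul_const x').const_add x
    have h2 : HasDerivAt (fun v => y + v * y') y' v := by
      simpa using ((hasDerivAt_id v).mul_const y').const_add y
    have h3 := (hθd _ hy).comp v h2
    have h4 := h3.rpow_const (p := ν + 1) (Or.inl (hθ0 _ hy).ne')
    have h5 := (hX.hasDerivAt_laplaceMoment Q 0 (mul_pos (hθ0 _ hy) (Real.exp_pos (x + v * x')))
      r).comp v (h3.mul h1.exp)
    convert! h4.mul h5 using 1
    simp only [Function.comp_apply, Pi.mul_apply, zero_add]
    have := hθ0 _ hy
    rw [Real.rpow_sub_one this.ne']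
    field_simp
    ring
  · intro x _ y hy s r hs hsr hrt
    have hl' : 0 < θ y * Real.exp x := mul_pos (hθ0 _ hy) (Real.exp_pos x)
    have i1 : ∀ j, Continuous (fun r => laplaceMoment Q X j (θ y * Real.exp x) r) := fun j => by
      refine continuousOn_univ.1 ((hX.continuousOn_laplaceMoment Q j).comp
        (f := fun r => (θ y * Real.exp x, r)) (by fun_prop) fun r _ => ⟨hl', mem_univ _⟩)
    have i2 : ∀ t, 0 ≤ t → IntervalIntegrable (fun r =>
        (S r * (-(ν + 1) / 2 * (θ y * Real.exp x) * laplaceMoment Q X 0 (θ y * Real.exp x) r +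
            (θ y * Real.exp x) ^ 2 / 2 * laplaceMoment Q X 1 (θ y * Real.exp x) r) -
          a r * (-(θ y * Real.exp x) * laplaceMoment Q X 1 (θ y * Real.exp x) r)))
          volume 0 t := fun t ht => by
      have := i1 0
      have := i1 1
      exact ((hc.intervalIntegrable_S t ht).mul_continuousOn (by fun_prop)).sub
        ((hc.intervalIntegrable_a t ht).mul_continuousOn (by fun_prop))
    have h1 := hX.laplaceMoment_sub_zero hc hB hl' (hs.trans hsr)
    have h2 := hX.laplaceMoment_sub_zero hc hB hl' hs
    have h3 := intervalIntegral.integral_interval_sub_left (i2 r (hs.trans hsr)) (i2 s hs)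
    rw [← h1, ← h2, sub_sub_sub_cancel_right] at h3
    change laplaceMoment Q X 0 _ r - laplaceMoment Q X 0 _ s = _ at h3
    rw [← mul_sub, ← intervalIntegral.integral_neg, h3, ← intervalIntegral.integral_const_mul]
    refine intervalIntegral.integral_congr fun u _ => ?_
    ring

end SDE

/-! ### Uniqueness of Laplace transforms on the half-line. -/

/-- The characteristic function of a finite measure on a bounded interval in terms of moments. -/
lemma hasSum_charFun_of_ae_abs_le_one (m : Measure ℝ) [IsFiniteMeasure m]
    (hm : ∀ᵐ u ∂m, |u| ≤ 1) (t : ℝ) :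
    HasSum (fun n : ℕ => (t * Complex.I) ^ n / (Nat.factorial n : ℂ) * ((∫ u, u ^ n ∂m : ℝ) : ℂ))
      (charFun m t) := by
  have h := hasSum_integral_of_dominated_convergence (μ := m)
    (F := fun (n : ℕ) (u : ℝ) => (t * u * Complex.I) ^ n / (Nat.factorial n : ℂ))
    (f := fun u : ℝ => Complex.exp (t * u * Complex.I))
    (fun n _ => |t| ^ n / (Nat.factorial n : ℝ)) (fun n => by fun_prop) ?_
    (ae_of_all _ fun _ => Real.summable_pow_div_factorial |t|) (integrable_const _) ?_
  · rw [charFun_apply_real]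
    convert! h using 2 with n
    rw [← integral_complex_ofReal, ← integral_const_mul]
    refine integral_congr_ae (ae_of_all _ fun u => ?_)
    simp only [Complex.ofReal_pow]
    ring
  · intro n
    filter_upwards [hm] with u hu
    simp only [norm_div, norm_pow, norm_mul, Complex.norm_real, Complex.norm_I, mul_one,
      Complex.norm_natCast, Real.norm_eq_abs]
    gcongr
    exact mul_le_of_le_one_right (abs_nonneg t) hu
  · refine ae_of_all _ fun u => ?_
    rw [Complex.exp_eq_exp_ℂ]
    exact NormedSpace.expSeries_div_hasSum_exp _

/-- A finite measure on `[0, ∞)` is determined by its Laplace transform at the integers. -/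
lemma MeasureTheory.Measure.ext_of_integral_exp_neg {m₁ m₂ : Measure ℝ} [IsFiniteMeasure m₁]
    [IsFiniteMeasure m₂] (h₁ : ∀ᵐ x ∂m₁, 0 ≤ x) (h₂ : ∀ᵐ x ∂m₂, 0 ≤ x)
    (h : ∀ n : ℕ, ∫ x, Real.exp (-(n * x)) ∂m₁ = ∫ x, Real.exp (-(n * x)) ∂m₂) : m₁ = m₂ := by
  -- Under `x ↦ e^{-x}` the image measure lives in `[-1, 1]`, and its moments are the Laplace
  -- transform at the integers. The map is then undone by `-log`.
  have hU : Measurable fun x : ℝ => Real.exp (-x) := by fun_prop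
  have hle : ∀ m : Measure ℝ, (∀ᵐ x ∂m, 0 ≤ x) →
      ∀ᵐ u ∂(m.map fun x => Real.exp (-x)), |u| ≤ 1 := by
    intro m hm
    rw [ae_map_iff hU.aemeasurable (measurableSet_le (by fun_prop) (by fun_prop))]
    filter_upwards [hm] with x hx
    rw [abs_of_pos (Real.exp_pos _), Real.exp_le_one_iff]
    linarith
  have hmom : ∀ (m : Measure ℝ) (n : ℕ),
      ∫ u, u ^ n ∂(m.map fun x => Real.exp (-x)) = ∫ x, Real.exp (-(n * x)) ∂m := by
    intro m n
    rw [integral_map hU.aemeasurable (by fun_prop)]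
    refine integral_congr_ae (ae_of_all _ fun x => ?_)
    simp only [← Real.exp_nat_mul]
    congr 1
    ring
  have hmap : m₁.map (fun x => Real.exp (-x)) = m₂.map fun x => Real.exp (-x) := by
    refine Measure.ext_of_charFun (funext fun t => ?_)
    have s1 := hasSum_charFun_of_ae_abs_le_one _ (hle m₁ h₁) t
    have s2 := hasSum_charFun_of_ae_abs_le_one _ (hle m₂ h₂) t
    simp only [hmom, h] at s1 s2
    exact s1.unique s2
  have hinv : ∀ m : Measure ℝ,
      (m.map fun x => Real.exp (-x)).map (fun u => -Real.log u) = m := by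
    intro m
    rw [Measure.map_map (by fun_prop) hU]
    have : ((fun u => -Real.log u) ∘ fun x : ℝ => Real.exp (-x)) = id := by
      funext x
      simp
    rw [this, Measure.map_id]
  rw [← hinv m₁, hmap, hinv]

/-! ### Identification of the law on events of the initial value. -/

section SDE

variable {Ω : Type*} [mΩ : MeasurableSpace Ω] {P : Measure Ω} {𝓕 : Filtration ℝ≥0 mΩ}
  {b σ : ℝ → ℝ → ℝ} {X : ℝ≥0 → Ω → ℝ} {ν : ℝ} {a S : ℝ → ℝ}

lemma IsNonnegSDESolution.ae_nonneg_initial (hX : IsNonnegSDESolution P 𝓕 b σ X) :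
    ∀ᵐ z ∂(P.map (X 0)), 0 ≤ z := by
  rw [ae_map_iff (hX.measurable 0).aemeasurable measurableSet_Ici]
  exact ae_of_all _ (hX.nonneg 0)

/-- The law of `e^{A(t)} X_t` on an event of the initial σ-algebra `σ(X_0)`. -/
lemma IsNonnegSDESolution.map_exp_mul_restrict [IsProbabilityMeasure P]
    (hX : IsNonnegSDESolution P 𝓕 b σ X) (hc : IsAffineCoeff ν a S b σ) (hν : -1 < ν) {B : Set ℝ}
    (hB : MeasurableSet B) {t : ℝ} (ht : 0 ≤ t) {A T : ℝ}
    (hA : A = ∫ u in (0 : ℝ)..t, a u)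
    (hT : T = 1 / 4 * ∫ u in (0 : ℝ)..t, S u * Real.exp (∫ s in (0 : ℝ)..u, a s)) (hT0 : 0 < T) :
    (P.restrict (X 0 ⁻¹' B)).map (fun ω => Real.exp A * X t.toNNReal ω) =
      (volume.restrict (Ioi 0)).withDensity
        (fun y => ∫⁻ z in B, ENNReal.ofReal (besqKernel ν T z y) ∂(P.map (X 0))) := by
  set Q := P.restrict (X 0 ⁻¹' B) with hQ
  have hX0 := hX.measurable 0
  have hXt := hX.measurable t.toNNReal
  have hKm := measurable_besqKernel hν T
  have hpB : (P.map (X 0)).restrict B = Q.map (X 0) := Measure.restrict_map hX0 hB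
  -- The value `l = 0`, outside the reach of the characteristics argument, is included to match
  -- total masses.
  have hlap : ∀ l : ℝ, 0 ≤ l → laplaceMoment Q X 0 (l * Real.exp A) t =
      (1 + 2 * T * l) ^ (-(ν + 1)) * laplaceMoment Q X 0 (l / (1 + 2 * T * l)) 0 := by
    intro l hl
    rcases hl.eq_or_lt with rfl | hl
    · simp [laplaceMoment]
    · have := hX.laplaceMoment_eq hc hB hl ht (A := fun r => ∫ u in (0 : ℝ)..r, a u)
        (τ := fun r => 1 / 4 * ∫ u in (0 : ℝ)..r, S u * Real.exp (∫ s in (0 : ℝ)..u, a s))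
        (fun _ => rfl) (fun _ => rfl)
      simp only [← hA, ← hT] at this
      exact this hT0.le
  have hinner : Measurable fun y => ∫⁻ z in B, ENNReal.ofReal (besqKernel ν T z y) ∂(P.map (X 0)) :=
    Measurable.lintegral_prod_left (hKm.ennreal_ofReal)
  have hdens : ∀ l : ℝ, 0 ≤ l → ∫⁻ y, ENNReal.ofReal (Real.exp (-(l * y)))
      ∂((volume.restrict (Ioi 0)).withDensity
        (fun y => ∫⁻ z in B, ENNReal.ofReal (besqKernel ν T z y) ∂(P.map (X 0)))) =
      ENNReal.ofReal ((1 + 2 * T * l) ^ (-(ν + 1)) *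
        laplaceMoment Q X 0 (l / (1 + 2 * T * l)) 0) := by
    intro l hl
    have hD : 0 < 1 + 2 * T * l := by positivity
    have hDp := Real.rpow_pos_of_pos hD (-(ν + 1))
    rw [lintegral_withDensity_eq_lintegral_mul _ hinner (by fun_prop)]
    have e1 : ∀ y, ((fun y => ∫⁻ z in B, ENNReal.ofReal (besqKernel ν T z y) ∂(P.map (X 0))) *
        fun y => ENNReal.ofReal (Real.exp (-(l * y)))) y =
        ∫⁻ z in B, ENNReal.ofReal (Real.exp (-(l * y)) * besqKernel ν T z y) ∂(P.map (X 0)) := by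
      intro y
      rw [Pi.mul_apply, mul_comm, ← lintegral_const_mul' _ _ ENNReal.ofReal_ne_top]
      simp_rw [ENNReal.ofReal_mul (Real.exp_pos _).le]
    have hswap : Measurable fun p : ℝ × ℝ =>
        ENNReal.ofReal (Real.exp (-(l * p.1)) * besqKernel ν T p.2 p.1) :=
      ((by fun_prop : Measurable fun p : ℝ × ℝ => Real.exp (-(l * p.1))).mul
        (hKm.comp measurable_swap)).ennreal_ofReal
    simp_rw [e1]
    rw [lintegral_lintegral_swap hswap.aemeasurable, hpB, lintegral_map
      (Measurable.lintegral_prod_left hswap) hX0]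
    rw [lintegral_congr fun ω => lintegral_exp_mul_besqKernel hν hT0 hl (hX.nonneg 0 ω),
      laplaceMoment, ← integral_const_mul, ofReal_integral_eq_lintegral_ofReal]
    · simp
    · simp only [pow_zero, one_mul]
      refine Integrable.of_bound (C := (1 + 2 * T * l) ^ (-(ν + 1)))
        (Measurable.aestronglyMeasurable (by
          have := hX.measurable (0 : ℝ).toNNReal
          fun_prop)) (ae_of_all _ fun ω => ?_)
      rw [Real.norm_of_nonneg (mul_nonneg hDp.le (Real.exp_pos _).le)]
      refine mul_le_of_le_one_right hDp.le (Real.exp_le_one_iff.2 (neg_nonpos.2 ?_))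
      exact mul_nonneg (by positivity) (hX.nonneg _ _)
    · exact ae_of_all _ fun ω => mul_nonneg hDp.le
        (mul_nonneg (pow_nonneg (hX.nonneg _ _) _) (Real.exp_pos _).le)
  have hfin : IsFiniteMeasure ((volume.restrict (Ioi 0)).withDensity
      (fun y => ∫⁻ z in B, ENNReal.ofReal (besqKernel ν T z y) ∂(P.map (X 0)))) := by
    refine ⟨?_⟩
    have := hdens 0 le_rfl
    simp only [zero_mul, neg_zero, Real.exp_zero, ENNReal.ofReal_one, lintegral_one] at this
    rw [this]
    exact ENNReal.ofReal_lt_top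
  have hYm : Measurable fun ω => Real.exp A * X t.toNNReal ω := hXt.const_mul _
  refine Measure.ext_of_integral_exp_neg ?_ ?_ fun n => ?_
  · rw [ae_map_iff hYm.aemeasurable measurableSet_Ici]
    exact ae_of_all _ fun ω => mul_nonneg (Real.exp_pos _).le (hX.nonneg _ _)
  · refine (withDensity_absolutelyContinuous _ _).ae_le ?_
    filter_upwards [ae_restrict_mem measurableSet_Ioi] with y hy using le_of_lt hy
  · have hn : (0 : ℝ) ≤ n := Nat.cast_nonneg n
    have hpos : 0 ≤ (1 + 2 * T * n) ^ (-(ν + 1)) *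
        laplaceMoment Q X 0 (n / (1 + 2 * T * n)) 0 :=
      mul_nonneg (Real.rpow_nonneg (by positivity) _) (integral_nonneg fun ω =>
        mul_nonneg (pow_nonneg (hX.nonneg _ _) _) (Real.exp_pos _).le)
    rw [integral_map hYm.aemeasurable (by fun_prop)]
    refine Eq.symm ?_
    rw [integral_eq_lintegral_of_nonneg_ae (ae_of_all _ fun _ => (Real.exp_pos _).le)
      (by fun_prop), hdens n hn, ENNReal.toReal_ofReal hpos, ← hlap n hn, laplaceMoment]
    simp only [pow_zero, one_mul, mul_assoc]

end SDE

/-! ### Marginal density, score and posterior law. -/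

/-- The density at time `T` of the squared Bessel process of index `ν` with initial law `m`. -/
noncomputable def besqDensity (m : Measure ℝ) (ν T y : ℝ) : ℝ :=
  (2 * T) ^ (-(ν + 1)) * y ^ ν * Real.exp (-y / (2 * T)) * besselMoment m T ν 0 y

/-- The density with respect to the initial law `m` of the law of the initial value of the squared
Bessel process given its value `y > 0` at time `T`. -/
noncomputable def besqPosterior (m : Measure ℝ) (ν T y z : ℝ) : ℝ :=
  z ^ 0 * Real.exp (-z / (2 * T)) * besselSeries ν (z * max y 0 / (4 * T ^ 2)) /
    besselMoment m T ν 0 (max y 0)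

section Density

variable {m : Measure ℝ} [IsProbabilityMeasure m] {ν T : ℝ}

lemma besqDensity_pos (hm : ∀ᵐ z ∂m, 0 ≤ z) (hν : -1 < ν) (hT : 0 < T) {y : ℝ} (hy : 0 < y) :
    0 < besqDensity m ν T y :=
  mul_pos (mul_pos (mul_pos (Real.rpow_pos_of_pos (by positivity) _) (Real.rpow_pos_of_pos hy _))
    (Real.exp_pos _)) (besselMoment_zero_pos m hm hν hT hy.le)

lemma besqPosterior_nonneg (hm : ∀ᵐ z ∂m, 0 ≤ z) (hν : -1 < ν) (hT : 0 < T) (y : ℝ) {z : ℝ}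
    (hz : 0 ≤ z) : 0 ≤ besqPosterior m ν T y z := by
  have h1 := besselMoment_zero_pos m hm hν hT (le_max_right y 0)
  have h2 : 0 ≤ max y 0 := le_max_right y 0
  have h3 := besselSeries_pos hν (w := z * max y 0 / (4 * T ^ 2)) (by positivity)
  unfold besqPosterior
  positivity

/-- Bayes' formula: marginal times posterior is the transition density. -/
lemma besqDensity_mul_besqPosterior (hm : ∀ᵐ z ∂m, 0 ≤ z) (hν : -1 < ν) (hT : 0 < T) {y : ℝ}
    (hy : 0 < y) (z : ℝ) :
    besqDensity m ν T y * besqPosterior m ν T y z = besqKernel ν T z y := by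
  have h1 := (besselMoment_zero_pos m hm hν hT hy.le).ne'
  rw [besqDensity, besqPosterior, besqKernel, max_eq_left hy.le,
    show -(z + y) / (2 * T) = -y / (2 * T) + -z / (2 * T) by ring, Real.exp_add]
  field_simp

lemma measurable_besqPosterior (hm : ∀ᵐ z ∂m, 0 ≤ z) (hν : -1 < ν) (hT : 0 < T) :
    Measurable (Function.uncurry (besqPosterior m ν T)) := by
  have h1 := (continuous_besselSeries hν).measurable
  have h2 := (contDiff_besselMoment m hm hν hT 0).continuous.measurable
  unfold besqPosterior Function.uncurry
  fun_prop

lemma integrable_besqPosterior (hm : ∀ᵐ z ∂m, 0 ≤ z) (hν : -1 < ν) (hT : 0 < T) (y : ℝ) :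
    Integrable (besqPosterior m ν T y) m :=
  (integrable_besselMoment m hm hν hT 0 (max y 0)).div_const _

/-- Because of `max y 0` the normaliser stays positive for all real `y`, so the posterior is a
Markov kernel on the whole line. -/
lemma lintegral_besqPosterior (hm : ∀ᵐ z ∂m, 0 ≤ z) (hν : -1 < ν) (hT : 0 < T) (y : ℝ) :
    ∫⁻ z, ENNReal.ofReal (besqPosterior m ν T y z) ∂m = 1 := by
  rw [← ofReal_integral_eq_lintegral_ofReal (integrable_besqPosterior hm hν hT y)
    (hm.mono fun z hz => besqPosterior_nonneg hm hν hT y hz)]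
  have h1 := (besselMoment_zero_pos m hm hν hT (le_max_right y 0)).ne'
  simp only [besqPosterior]
  rw [integral_div, ← besselMoment, div_self h1, ENNReal.ofReal_one]

lemma setLIntegral_besqKernel (hm : ∀ᵐ z ∂m, 0 ≤ z) (hν : -1 < ν) (hT : 0 < T) {y : ℝ}
    (hy : 0 < y) (B : Set ℝ) :
    ∫⁻ z in B, ENNReal.ofReal (besqKernel ν T z y) ∂m =
      ENNReal.ofReal (besqDensity m ν T y) *
        ∫⁻ z in B, ENNReal.ofReal (besqPosterior m ν T y z) ∂m := by
  rw [← lintegral_const_mul' _ _ ENNReal.ofReal_ne_top]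
  refine lintegral_congr fun z => ?_
  rw [← ENNReal.ofReal_mul (besqDensity_pos hm hν hT hy).le,
    besqDensity_mul_besqPosterior hm hν hT hy]

lemma lintegral_besqKernel (hm : ∀ᵐ z ∂m, 0 ≤ z) (hν : -1 < ν) (hT : 0 < T) {y : ℝ}
    (hy : 0 < y) :
    ∫⁻ z, ENNReal.ofReal (besqKernel ν T z y) ∂m = ENNReal.ofReal (besqDensity m ν T y) := by
  rw [← setLIntegral_univ, setLIntegral_besqKernel hm hν hT hy, setLIntegral_univ,
    lintegral_besqPosterior hm hν hT, mul_one]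

lemma contDiffOn_besqDensity (hm : ∀ᵐ z ∂m, 0 ≤ z) (hν : -1 < ν) (hT : 0 < T) :
    ContDiffOn ℝ 1 (besqDensity m ν T) (Ioi 0) := by
  have h1 : ContDiffOn ℝ 1 (fun y : ℝ => y ^ ν) (Ioi 0) := fun y hy =>
    (Real.contDiffAt_rpow_const_of_ne (ne_of_gt hy)).contDiffWithinAt
  have h2 : ContDiff ℝ 1 (fun y : ℝ => Real.exp (-y / (2 * T))) := by fun_prop
  exact ((contDiffOn_const.mul h1).mul h2.contDiffOn).mul
    (contDiff_besselMoment m hm hν hT 0).contDiffOn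

lemma measurable_besqDensity (hm : ∀ᵐ z ∂m, 0 ≤ z) (hν : -1 < ν) (hT : 0 < T) :
    Measurable (besqDensity m ν T) := by
  have := (contDiff_besselMoment m hm hν hT 0).continuous.measurable
  unfold besqDensity
  fun_prop

/-- The three terms come from `y ^ ν`, the exponential and the integral over the initial law. -/
lemma hasDerivAt_log_besqDensity (hm : ∀ᵐ z ∂m, 0 ≤ z) (hν : -1 < ν) (hT : 0 < T) {y : ℝ}
    (hy : 0 < y) :
    HasDerivAt (fun y => Real.log (besqDensity m ν T y))
      (ν / y - 1 / (2 * T) +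
        besselMoment m T (ν + 1) 1 y / (4 * T ^ 2) / besselMoment m T ν 0 y) y := by
  have h1 := (Real.hasDerivAt_log hy.ne').const_mul ν
  have h2 : HasDerivAt (fun y => -y / (2 * T)) (-1 / (2 * T)) y :=
    (hasDerivAt_id y).fun_neg.div_const _
  have h3 := (hasDerivAt_besselMoment m hm hν hT 0 y).log
    (besselMoment_zero_pos m hm hν hT hy.le).ne'
  have h4 := ((h1.const_add (Real.log ((2 * T) ^ (-(ν + 1))))).add h2).add h3
  refine (h4.congr_of_eventuallyEq ?_).congr_deriv ?_
  · filter_upwards [Ioi_mem_nhds hy] with u hu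
    have hu : 0 < u := hu
    rw [besqDensity, Real.log_mul _ (besselMoment_zero_pos m hm hν hT hu.le).ne',
      Real.log_mul _ (Real.exp_pos _).ne', Real.log_mul, Real.log_rpow hu, Real.log_exp]
    · rfl
    · exact (Real.rpow_pos_of_pos (by positivity) _).ne'
    · exact (Real.rpow_pos_of_pos hu _).ne'
    · exact (mul_pos (Real.rpow_pos_of_pos (by positivity) _) (Real.rpow_pos_of_pos hu _)).ne'
    · exact (mul_pos (mul_pos (Real.rpow_pos_of_pos (by positivity) _)
        (Real.rpow_pos_of_pos hu _)) (Real.exp_pos _)).ne'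
  · simp only [zero_add]
    ring

/-- The law of the initial value of the squared Bessel process given its value at time `T`. -/
noncomputable def besqPosteriorKernel (m : Measure ℝ) [IsProbabilityMeasure m] (ν T : ℝ) :
    Kernel ℝ ℝ :=
  (Kernel.const ℝ m).withDensity fun y z => ENNReal.ofReal (besqPosterior m ν T y z)

lemma besqPosteriorKernel_apply (hm : ∀ᵐ z ∂m, 0 ≤ z) (hν : -1 < ν) (hT : 0 < T) (y : ℝ) :
    besqPosteriorKernel m ν T y =
      m.withDensity fun z => ENNReal.ofReal (besqPosterior m ν T y z) := by
  rw [besqPosteriorKernel, Kernel.withDensity_apply _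
    (measurable_besqPosterior hm hν hT).ennreal_ofReal, Kernel.const_apply]

lemma isMarkovKernel_besqPosteriorKernel (hm : ∀ᵐ z ∂m, 0 ≤ z) (hν : -1 < ν) (hT : 0 < T) :
    IsMarkovKernel (besqPosteriorKernel m ν T) := by
  refine ⟨fun y => ⟨?_⟩⟩
  rw [besqPosteriorKernel_apply hm hν hT, withDensity_apply _ MeasurableSet.univ,
    setLIntegral_univ, lintegral_besqPosterior hm hν hT]

/-- The integral of the Bessel quotient against the posterior law. -/
lemma integrable_besselWeight_besqPosteriorKernel (hm : ∀ᵐ z ∂m, 0 ≤ z) (hν : -1 < ν) (hT : 0 < T)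
    {y : ℝ} (hy : 0 < y) :
    Integrable (besselWeight ν T y) (besqPosteriorKernel m ν T y) ∧
      ∫ z, besselWeight ν T y z ∂(besqPosteriorKernel m ν T y) =
        √y / (2 * T) * (besselMoment m T (ν + 1) 1 y / besselMoment m T ν 0 y) := by
  have hmeas : Measurable fun z => ENNReal.ofReal (besqPosterior m ν T y z) :=
    ((measurable_besqPosterior hm hν hT).comp measurable_prodMk_left).ennreal_ofReal
  have hint := (integrable_besselMoment m hm (ν := ν + 1) (by linarith) hT 1 y).const_mul
    (√y / (2 * T) / besselMoment m T ν 0 y)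
  -- The series of index `ν` in the posterior cancels the denominator of the Bessel quotient,
  -- leaving the integrand of the differentiated moment.
  have hae : (fun z => √y / (2 * T) / besselMoment m T ν 0 y *
      (z ^ 1 * Real.exp (-z / (2 * T)) * besselSeries (ν + 1) (z * y / (4 * T ^ 2)))) =ᵐ[m]
      fun z => (ENNReal.ofReal (besqPosterior m ν T y z)).toReal • besselWeight ν T y z := by
    filter_upwards [hm] with z hz
    have h1 := (besselSeries_pos hν (w := z * y / (4 * T ^ 2)) (by positivity)).ne'
    rw [ENNReal.toReal_ofReal (besqPosterior_nonneg hm hν hT y hz), besselWeight_eq hT hy hz,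
      besqPosterior, max_eq_left hy.le, smul_eq_mul]
    generalize besselSeries ν (z * y / (4 * T ^ 2)) = J at h1 ⊢
    generalize besselSeries (ν + 1) (z * y / (4 * T ^ 2)) = J'
    field_simp
  rw [besqPosteriorKernel_apply hm hν hT,
    integrable_withDensity_iff_integrable_smul' hmeas (ae_of_all _ fun _ => ENNReal.ofReal_lt_top),
    integral_withDensity_eq_integral_toReal_smul hmeas
      (ae_of_all _ fun _ => ENNReal.ofReal_lt_top)]
  refine ⟨hint.congr hae, ?_⟩
  rw [← integral_congr_ae hae, integral_const_mul, ← besselMoment]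
  ring

end Density

/-! ### Rescaling of densities and of null sets. -/

/-- The density of `X` if `c X` has the density `f` on `(0, ∞)`. -/
lemma map_eq_withDensity_of_map_const_mul {Ω : Type*} [MeasurableSpace Ω] {P : Measure Ω}
    {Y : Ω → ℝ} (hY : Measurable Y) {c : ℝ} (hc : 0 < c) {f : ℝ → ℝ≥0∞} (hf : Measurable f)
    (h : P.map (fun ω => c * Y ω) = (volume.restrict (Ioi 0)).withDensity f) :
    P.map Y = (volume.restrict (Ioi 0)).withDensity fun x => ENNReal.ofReal c * f (c * x) := by
  have hvol : (volume : Measure ℝ) = ENNReal.ofReal c • Measure.map (c * ·) volume := by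
    have := Real.smul_map_volume_mul_left hc.ne'
    rwa [abs_of_pos hc, eq_comm] at this
  have hcm : Measurable (c * · : ℝ → ℝ) := measurable_const_mul c
  have hcm' : Measurable (c⁻¹ * · : ℝ → ℝ) := measurable_const_mul c⁻¹
  have hfc : Measurable fun x => ENNReal.ofReal c * f (c * x) := (hf.comp hcm).const_mul _
  ext s hs
  have e1 : Y ⁻¹' s = (fun ω => c * Y ω) ⁻¹' ((c⁻¹ * ·) ⁻¹' s) := by
    ext ω
    simp [hc.ne']
  have hs' : MeasurableSet ((c⁻¹ * ·) ⁻¹' s : Set ℝ) := hcm' hs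
  rw [Measure.map_apply hY hs, e1, ← Measure.map_apply (hY.const_mul c) hs', h,
    withDensity_apply _ hs', withDensity_apply _ hs, Measure.restrict_restrict hs',
    Measure.restrict_restrict hs, ← lintegral_indicator (hs'.inter measurableSet_Ioi),
    ← lintegral_indicator (hs.inter measurableSet_Ioi)]
  conv_lhs => rw [hvol]
  rw [lintegral_smul_measure, lintegral_map (hf.indicator (hs'.inter measurableSet_Ioi)) hcm,
    smul_eq_mul, ← lintegral_const_mul' _ _ ENNReal.ofReal_ne_top]
  refine lintegral_congr fun x => ?_
  by_cases hx : x ∈ s ∩ Ioi 0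
  · rw [indicator_of_mem hx, indicator_of_mem]
    exact ⟨by simpa [hc.ne'] using hx.1, mul_pos hc hx.2⟩
  · rw [indicator_of_notMem hx, indicator_of_notMem, mul_zero]
    rintro ⟨h1, h2⟩
    exact hx ⟨by simpa [hc.ne'] using h1, (mul_pos_iff_of_pos_left hc).1 h2⟩

/-- A property that holds almost everywhere on `(0, ∞)` also does after rescaling. -/
lemma ae_restrict_Ioi_comp_const_mul {c : ℝ} (hc : 0 < c) {p : ℝ → Prop}
    (h : ∀ᵐ y ∂(volume.restrict (Ioi (0 : ℝ))), p y) :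
    ∀ᵐ x ∂(volume.restrict (Ioi (0 : ℝ))), p (c * x) := by
  rw [ae_restrict_iff' measurableSet_Ioi] at h ⊢
  have hq : Measure.QuasiMeasurePreserving (c * · : ℝ → ℝ) volume volume := by
    refine ⟨measurable_const_mul c, ?_⟩
    rw [Real.map_volume_mul_left hc.ne']
    exact Measure.smul_absolutelyContinuous
  filter_upwards [hq.ae h] with x hx hx0 using hx (mul_pos hc hx0)

/-! ### Conditional law and Tweedie's formula. -/

section Tweedie

variable {Ω : Type*} [mΩ : MeasurableSpace Ω] {P : Measure Ω} [IsProbabilityMeasure P]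
  {𝓕 : Filtration ℝ≥0 mΩ} {b σ : ℝ → ℝ → ℝ} {X : ℝ≥0 → Ω → ℝ} {ν : ℝ} {a S : ℝ → ℝ}

/-- The density of `e^{A(t)} X_t`. -/
lemma IsNonnegSDESolution.map_exp_mul (hX : IsNonnegSDESolution P 𝓕 b σ X)
    (hc : IsAffineCoeff ν a S b σ) (hν : -1 < ν) {t : ℝ} (ht : 0 ≤ t) {A T : ℝ}
    (hA : A = ∫ u in (0 : ℝ)..t, a u)
    (hT : T = 1 / 4 * ∫ u in (0 : ℝ)..t, S u * Real.exp (∫ s in (0 : ℝ)..u, a s)) (hT0 : 0 < T) :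
    P.map (fun ω => Real.exp A * X t.toNNReal ω) =
      (volume.restrict (Ioi 0)).withDensity
        fun y => ENNReal.ofReal (besqDensity (P.map (X 0)) ν T y) := by
  have := Measure.isProbabilityMeasure_map (μ := P) (hX.measurable 0).aemeasurable
  have h := hX.map_exp_mul_restrict hc hν MeasurableSet.univ ht hA hT hT0
  simp only [preimage_univ, Measure.restrict_univ] at h
  rw [h]
  refine withDensity_congr_ae ?_
  filter_upwards [ae_restrict_mem measurableSet_Ioi] with y hy
  exact lintegral_besqKernel hX.ae_nonneg_initial hν hT0 hy

lemma isAffineCoeff_besq (ν : ℝ) :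
    IsAffineCoeff ν (fun _ => 0) (fun _ => 4) (fun _ _ => 2 * (ν + 1)) (fun _ x => 2 * √x) where
  drift r _ x _ := by ring
  diffusion r _ x hx := by rw [mul_pow, Real.sq_sqrt hx]; ring
  intervalIntegrable_a _ _ := intervalIntegrable_const
  intervalIntegrable_S _ _ := intervalIntegrable_const
  a_nonneg _ _ := le_rfl
  S_nonneg _ _ := by norm_num

/-- The joint law of the initial and the time-`T` values of a squared Bessel process, on
rectangles. -/
lemma IsBESQ.map_restrict (hX : IsBESQ P 𝓕 ν X) (hν : -1 < ν) {T : ℝ} (hT : 0 < T) {B : Set ℝ}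
    (hB : MeasurableSet B) :
    (P.restrict (X 0 ⁻¹' B)).map (X T.toNNReal) =
      (volume.restrict (Ioi 0)).withDensity
        (fun y => ∫⁻ z in B, ENNReal.ofReal (besqKernel ν T z y) ∂(P.map (X 0))) := by
  -- With `a = 0` and `S = 4` the clock runs at unit speed, so the kernel time is `T` itself.
  simpa using IsNonnegSDESolution.map_exp_mul_restrict hX (isAffineCoeff_besq ν) hν hB hT.le
    (A := 0) (T := T) (by simp) (by simp; ring) hT

/-- The marginal law of a squared Bessel process. -/
lemma IsBESQ.map_eq (hX : IsBESQ P 𝓕 ν X) (hν : -1 < ν) {T : ℝ} (hT : 0 < T) :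
    P.map (X T.toNNReal) = (volume.restrict (Ioi 0)).withDensity
        fun y => ENNReal.ofReal (besqDensity (P.map (X 0)) ν T y) := by
  simpa using IsNonnegSDESolution.map_exp_mul hX (isAffineCoeff_besq ν) hν hT.le
    (A := 0) (T := T) (by simp) (by simp; ring) hT

/-- The joint law on rectangles disintegrates through Bayes' formula. The conditional law is
determined only up to null sets of the law of `X T.toNNReal`; positivity of the density turns this
into Lebesgue almost everywhere on `(0, ∞)`. -/
lemma IsBESQ.condDistrib_ae_eq (hX : IsBESQ P 𝓕 ν X) (hν : -1 < ν) {T : ℝ} (hT : 0 < T)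
    [IsProbabilityMeasure (P.map (X 0))] :
    condDistrib (X 0) (X T.toNNReal) P =ᵐ[volume.restrict (Ioi 0)]
      besqPosteriorKernel (P.map (X 0)) ν T := by
  set m := P.map (X 0)
  have hm : ∀ᵐ z ∂m, 0 ≤ z := IsNonnegSDESolution.ae_nonneg_initial hX
  have hX0 := IsNonnegSDESolution.measurable hX 0
  have hXT := IsNonnegSDESolution.measurable hX T.toNNReal
  have hqm := measurable_besqDensity hm hν hT
  have := isMarkovKernel_besqPosteriorKernel hm hν hT
  have hlaw := hX.map_eq hν hT
  have hac : volume.restrict (Ioi (0 : ℝ)) ≪ P.map (X T.toNNReal) := by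
    rw [hlaw]
    refine withDensity_absolutelyContinuous' hqm.ennreal_ofReal.aemeasurable ?_
    filter_upwards [ae_restrict_mem measurableSet_Ioi] with y hy
    exact (ENNReal.ofReal_pos.2 (besqDensity_pos hm hν hT hy)).ne'
  refine hac.ae_le (condDistrib_ae_eq_of_measure_eq_compProd _ hX0.aemeasurable ?_)
  have := Measure.isProbabilityMeasure_map (μ := P) (hXT.prodMk hX0).aemeasurable
  refine Measure.ext_prod fun {s B} hs hB => ?_
  rw [Measure.map_apply (hXT.prodMk hX0) (hs.prod hB), Measure.compProd_apply_prod hs hB]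
  have e1 : (fun ω => (X T.toNNReal ω, X 0 ω)) ⁻¹' s ×ˢ B = X T.toNNReal ⁻¹' s ∩ X 0 ⁻¹' B := rfl
  rw [e1, ← Measure.restrict_apply (hXT hs), ← Measure.map_apply hXT hs, hX.map_restrict hν hT hB,
    withDensity_apply _ hs, hlaw, restrict_withDensity hs,
    lintegral_withDensity_eq_lintegral_mul _ hqm.ennreal_ofReal (Kernel.measurable_coe _ hB)]
  refine lintegral_congr_ae ?_
  filter_upwards [ae_restrict_of_ae (s := s) (ae_restrict_mem (μ := volume) measurableSet_Ioi)]
    with y hy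
  rw [Pi.mul_apply, besqPosteriorKernel_apply hm hν hT, withDensity_apply _ hB]
  exact setLIntegral_besqKernel hm hν hT hy B

/-- Tweedie's formula for a diffusion with affine coefficients. -/
lemma IsNonnegSDESolution.tweedieFormula (hX : IsNonnegSDESolution P 𝓕 b σ X)
    (hc : IsAffineCoeff ν a S b σ) (hν : -1 < ν) {Ω' : Type*} [mΩ' : MeasurableSpace Ω']
    {P' : Measure Ω'} [IsProbabilityMeasure P'] {𝓕' : Filtration ℝ≥0 mΩ'} {Z : ℝ≥0 → Ω' → ℝ}
    (hZ : IsBESQ P' 𝓕' ν Z) (hXZ : P.map (X 0) = P'.map (Z 0)) {t : ℝ} (ht : 0 ≤ t) {A T : ℝ}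
    (hA : A = ∫ u in (0 : ℝ)..t, a u)
    (hT : T = 1 / 4 * ∫ u in (0 : ℝ)..t, S u * Real.exp (∫ s in (0 : ℝ)..u, a s)) (hT0 : 0 < T) :
    TweedieFormula P P' X Z ν t A T := by
  have hprob := Measure.isProbabilityMeasure_map (μ := P')
    (IsNonnegSDESolution.measurable hZ 0).aemeasurable
  have hm := IsNonnegSDESolution.ae_nonneg_initial hZ
  have hcond := hZ.condDistrib_ae_eq hν hT0
  have hlawX := hX.map_exp_mul hc hν ht hA hT hT0
  rw [hXZ] at hlawX
  have hlawZ := hZ.map_eq hν hT0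
  set m := P'.map (Z 0)
  have he := Real.exp_pos A
  have hscore : ∀ y, 0 < y → score (besqDensity m ν T) y = ν / y - 1 / (2 * T) +
      besselMoment m T (ν + 1) 1 y / (4 * T ^ 2) / besselMoment m T ν 0 y := fun y hy =>
    (hasDerivAt_log_besqDensity hm hν hT0 hy).deriv
  have hscore' : ∀ x, 0 < x →
      score (fun x => Real.exp A * besqDensity m ν T (Real.exp A * x)) x =
        Real.exp A * score (besqDensity m ν T) (Real.exp A * x) := by
    intro x hx
    have hl : HasDerivAt (fun x => Real.exp A * x) (Real.exp A) x := by
      simpa using (hasDerivAt_id x).const_mul (Real.exp A)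
    have h1 := ((hasDerivAt_log_besqDensity hm hν hT0 (mul_pos he hx)).comp x hl).const_add A
    rw [hscore _ (mul_pos he hx), mul_comm]
    refine (h1.congr_of_eventuallyEq ?_).deriv
    filter_upwards [Ioi_mem_nhds hx] with u hu
    rw [Real.log_mul he.ne' (besqDensity_pos hm hν hT0 (mul_pos he hu)).ne', Real.log_exp]
    rfl
  have htweedie : ∀ᵐ y ∂(volume.restrict (Ioi (0 : ℝ))),
      Integrable (besselWeight ν T y) (condDistrib (Z 0) (Z T.toNNReal) P' y) ∧
        score (besqDensity m ν T) y = besqTweedie P' Z ν T y := by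
    filter_upwards [hcond, ae_restrict_mem measurableSet_Ioi] with y hy hy0
    have hy0 : 0 < y := hy0
    obtain ⟨h1, h2⟩ := integrable_besselWeight_besqPosteriorKernel hm hν hT0 hy0
    rw [besqTweedie, hy, h2, hscore y hy0]
    refine ⟨h1, ?_⟩
    have h3 := (Real.sqrt_pos.2 hy0).ne'
    field_simp
    ring
  refine ⟨fun x => Real.exp A * besqDensity m ν T (Real.exp A * x), besqDensity m ν T,
    ⟨fun x hx => mul_pos he (besqDensity_pos hm hν hT0 (mul_pos he hx)), ?_, ?_⟩,
    ⟨fun x hx => besqDensity_pos hm hν hT0 hx, contDiffOn_besqDensity hm hν hT0, hlawZ⟩,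
    hscore', ?_⟩
  · refine contDiffOn_const.mul ((contDiffOn_besqDensity hm hν hT0).comp
      (contDiff_const.mul contDiff_id).contDiffOn fun x hx => mul_pos he hx)
  · rw [map_eq_withDensity_of_map_const_mul (hX.measurable _) he
      (measurable_besqDensity hm hν hT0).ennreal_ofReal hlawX]
    simp_rw [ENNReal.ofReal_mul he.le]
  · filter_upwards [ae_restrict_Ioi_comp_const_mul he htweedie, ae_restrict_mem measurableSet_Ioi]
      with x hx hx0
    exact ⟨hx.1, by rw [hscore' x hx0, hx.2]⟩

end Tweedie

theorem mainTheorem4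
    {Ω Ω' : Type*} [mΩ : MeasurableSpace Ω] [mΩ' : MeasurableSpace Ω']
    (P : Measure Ω) [IsProbabilityMeasure P] (P' : Measure Ω') [IsProbabilityMeasure P']
    (𝓕 : Filtration ℝ≥0 mΩ) (𝓕' : Filtration ℝ≥0 mΩ')
    (pdata : Measure ℝ)
    (α μ σ : ℝ → ℝ) (ν : ℝ)
    (hα : ∀ t, 0 ≤ t → 0 < α t) (hμ : ∀ t, 0 ≤ t → 0 < μ t) (hσ : ∀ t, 0 ≤ t → 0 < σ t)
    (hα_int : ∀ t, 0 ≤ t → IntervalIntegrable α volume 0 t)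
    (hσ_int : ∀ t, 0 ≤ t → IntervalIntegrable (fun s => σ s ^ 2) volume 0 t)
    (hν : ∀ t, 0 ≤ t → 2 * α t * μ t / σ t ^ 2 - 1 = ν)
    (X : ℝ≥0 → Ω → ℝ) (hX : IsCIR P 𝓕 α μ σ X) (hX0 : HasLaw (X 0) pdata P)
    (Z : ℝ≥0 → Ω' → ℝ) (hZ : IsBESQ P' 𝓕' ν Z) (hZ0 : HasLaw (Z 0) pdata P')
    (t : ℝ) (ht : 0 < t) :
    TweedieFormula P P' X Z ν t (∫ s in (0 : ℝ)..t, α s)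
      (1 / 4 * ∫ s in (0 : ℝ)..t, σ s ^ 2 * Real.exp (∫ u in (0 : ℝ)..s, α u)) ∧
    ∀ α₀ μ₀ σ₀ : ℝ, (∀ s, 0 ≤ s → α s = α₀ ∧ μ s = μ₀ ∧ σ s = σ₀) →
      TweedieFormula P P' X Z (2 * α₀ * μ₀ / σ₀ ^ 2 - 1) t (α₀ * t)
        (σ₀ ^ 2 / (4 * α₀) * (Real.exp (α₀ * t) - 1)) := by
  have hν1 : -1 < ν := by
    have h1 := hα 0 le_rfl
    have h2 := hμ 0 le_rfl
    have h3 := hσ 0 le_rfl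
    rw [← hν 0 le_rfl]
    have : 0 < 2 * α 0 * μ 0 / σ 0 ^ 2 := by positivity
    linarith
  -- The constant index enters here, as `α μ = (ν + 1) / 2 * σ²`.
  have hc : IsAffineCoeff ν α (fun s => σ s ^ 2) (fun t x => α t * (μ t - x))
      (fun t x => σ t * √x) :=
    { drift := fun r hr x _ => by
        have := (hσ r hr).ne'
        rw [← hν r hr]
        field_simp
        ring
      diffusion := fun r _ x hx => by rw [mul_pow, Real.sq_sqrt hx]
      intervalIntegrable_a := hα_int
      intervalIntegrable_S := hσ_int
      a_nonneg := fun r hr => (hα r hr).le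
      S_nonneg := fun r _ => sq_nonneg _ }
  have hτint : IntervalIntegrable
      (fun s => σ s ^ 2 * Real.exp (∫ u in (0 : ℝ)..s, α u)) volume 0 t :=
    (hσ_int t ht.le).mul_continuousOn
      (intervalIntegral.continuousOn_primitive_interval' (hα_int t ht.le) left_mem_uIcc).rexp
  have hτ0 : 0 < 1 / 4 * ∫ s in (0 : ℝ)..t, σ s ^ 2 * Real.exp (∫ u in (0 : ℝ)..s, α u) := by
    refine mul_pos (by norm_num) (intervalIntegral.intervalIntegral_pos_of_pos_on hτint
      (fun s hs => ?_) ht)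
    exact mul_pos (pow_pos (hσ s hs.1.le) 2) (Real.exp_pos _)
  have hmain := IsNonnegSDESolution.tweedieFormula hX hc hν1 hZ
    (hX0.map_eq.trans hZ0.map_eq.symm) ht.le rfl rfl hτ0
  refine ⟨hmain, fun α₀ μ₀ σ₀ h => ?_⟩
  obtain ⟨h1, h2, h3⟩ := h 0 le_rfl
  have hα₀ : 0 < α₀ := h1 ▸ hα 0 le_rfl
  have eν : 2 * α₀ * μ₀ / σ₀ ^ 2 - 1 = ν := by rw [← hν 0 le_rfl, h1, h2, h3]
  have eA : ∀ r, 0 ≤ r → ∫ s in (0 : ℝ)..r, α s = α₀ * r := by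
    intro r hr
    rw [intervalIntegral.integral_congr (g := fun _ => α₀) fun s hs => ?_]
    · simp [mul_comm]
    · rw [uIcc_of_le hr] at hs
      exact (h s hs.1).1
  have eτ : 1 / 4 * ∫ s in (0 : ℝ)..t, σ s ^ 2 * Real.exp (∫ u in (0 : ℝ)..s, α u) =
      σ₀ ^ 2 / (4 * α₀) * (Real.exp (α₀ * t) - 1) := by
    rw [intervalIntegral.integral_congr (g := fun s => σ₀ ^ 2 * Real.exp (α₀ * s)) fun s hs => ?_]
    · rw [intervalIntegral.integral_const_mul, intervalIntegral.integral_comp_mul_left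
        (fun s => Real.exp s) hα₀.ne', integral_exp]
      simp only [mul_zero, Real.exp_zero, smul_eq_mul]
      field_simp
    · rw [uIcc_of_le ht.le] at hs
      simp only [(h s hs.1).2.2, eA s hs.1]
  rw [eν, ← eτ, ← eA t ht.le]
  exact hmain
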